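/- Let $\Omega$ be a Polish space, $\pi$ a Borel probability measure on $\Omega$, and $\mathcal{A}$ the completion of the Borel $\sigma$-algebra of $\Omega$ with respect to $\pi$. Let $(X,\|\cdot\|_X)$ be a separable Banach space and $p\in[1,+\infty)$. Let $\mathcal{P}_p(X)$ be the set of Borel probability measures on $X$ with $\int_X\|x\|_X^p\,\mathrm{d}\mu(x)<+\infty$, equipped with the Wasserstein distance $$W_p(\mu,\nu)=\inf_{\gamma}\Big(\int_{X\times X}\|x-y\|_X^p\,\mathrm{d}\gamma(x,y)\Big)^{1/p},$$ where $\gamma$ runs over all probability measures on $X\times X$ with marginals $\mu$ and $\nu$. Let $\mathcal{P}_{\pi,p}(\Omega\times X)$ be the set of Borel probability measures $\boldsymbol{\mu}$ on $\Omega\times X$ with first marginal $\pi$ whose disintegration $\boldsymbol{\mu}=\int_\Omega\mu_\omega\,\mathrm{d}\pi(\omega)$ satisfies $\int_\Omega\int_X\|x\|_X^p\,\mathrm{d}\mu_\omega(x)\,\mathrm{d}\pi(\omega)<+\infty$, equipped with the fibred Wasserstein distance $$W_{\pi,p}(\boldsymbol{\mu},\boldsymbol{\nu})=\Big(\int_\Omega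 W_p(\mu_\omega,\nu_\omega)^p\,\mathrm{d}\pi(\omega)\Big)^{1/p}.$$ For $A\in\mathcal{A}$ with $\pi(A)>0$, let $m_A(\boldsymbol{\mu}):=\frac{1}{\pi(A)}\int_A\mu_\omega\,\mathrm{d}\pi(\omega)\in\mathcal{P}_p(X)$ be the average of the fibres of $\boldsymbol{\mu}$ over $A$. For a finite partition $P=(A_1,\dots,A_n)$ of $\Omega$ into pairwise disjoint sets $A_i\in\mathcal{A}$ with $\pi(A_i)>0$, let $$\mathbb{E}_P[\boldsymbol{\mu}]:=\int_\Omega\sum_{i=1}^nm_{A_i}(\boldsymbol{\mu})\,\mathbf{1}_{A_i}(\omega)\,\mathrm{d}\pi(\omega)\in\mathcal{P}_{\pi,p}(\Omega\times X).$$ Theorem. A subset $\mathcal{K}\subset\mathcal{P}_{\pi,p}(\Omega\times X)$ is relatively compact for the metric $W_{\pi,p}$ (its closure in $\mathcal{P}_{\pi,p}(\Omega\times X)$ is compact) if and only if both of the following conditions hold. (i) For every $A\in\mathcal{A}$ with $\pi(A)>0$, the set $\big\{m_A(\boldsymbol{\mu}) : \boldsymbol{\mu}\in\mathcal{K}\big\}$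 is relatively compact in $(\mathcal{P}_p(X),W_p)$. (ii) For every $\varepsilon>0$ there exists a finite partition $P_\varepsilon=(A_1,\dots,A_{n_\varepsilon})$ of $\Omega$ into sets of $\mathcal{A}$ of positive $\pi$-measure such that $$\sup_{\boldsymbol{\mu}\in\mathcal{K}}W_{\pi,p}\big(\boldsymbol{\mu},\mathbb{E}_{P_\varepsilon}[\boldsymbol{\mu}]\big)\le\varepsilon.$$ -/

import Mathlib

open MeasureTheory ProbabilityTheory TopologicalSpace
open scoped ENNReal

noncomputable section

/-- The topology induced by a distance `d`: a set is open when it contains an open ball of positive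
radius around each of its points. (No axiom on `d` is needed for this to be a topology.) -/
@[reducible]
def topologyOfDist {α : Type*} (d : α → α → ℝ≥0∞) : TopologicalSpace α where
  IsOpen U := ∀ x ∈ U, ∃ ε : ℝ≥0∞, 0 < ε ∧ ∀ y, d y x < ε → y ∈ U
  isOpen_univ := fun _ _ => ⟨1, one_pos, fun _ _ => trivial⟩
  isOpen_inter := by
    rintro U V hU hV x ⟨hxU, hxV⟩
    obtain ⟨a, ha, hUa⟩ := hU x hxU
    obtain ⟨b, hb, hVb⟩ := hV x hxV
    exact ⟨min a b, lt_min ha hb, fun y hy =>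
      ⟨hUa y (hy.trans_le (min_le_left a b)), hVb y (hy.trans_le (min_le_right a b))⟩⟩
  isOpen_sUnion := by
    rintro S hS x ⟨U, hU, hx⟩
    obtain ⟨a, ha, hUa⟩ := hS U hU x hx
    exact ⟨a, ha, fun y hy => ⟨U, hU, hUa y hy⟩⟩

/-! ### Wasserstein spaces -/

/-- Transport plans between `μ` and `ν`. -/
def transportPlans {X : Type*} [MeasurableSpace X] (μ ν : Measure X) : Set (Measure (X × X)) :=
  {γ | IsProbabilityMeasure γ ∧ γ.map Prod.fst = μ ∧ γ.map Prod.snd = ν}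

/-- The Wasserstein distance `W_p(μ, ν)`, with values in `[0, ∞]`
(it is finite as soon as both measures are probabilities with finite `p`-moment). -/
def wassersteinDist {X : Type*} [MeasurableSpace X] [PseudoEMetricSpace X]
    (p : ℝ) (μ ν : Measure X) : ℝ≥0∞ :=
  ⨅ γ ∈ transportPlans μ ν, (∫⁻ z, edist z.1 z.2 ^ p ∂γ) ^ (1 / p)

/-- The space `P_p(X)` of Borel probability measures on `X` with finite moment of order `p`. -/
@[ext]
structure WassersteinSpace (p : ℝ) (X : Type*) [NormedAddCommGroup X] [MeasurableSpace X] where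
  toMeasure : Measure X
  isProb : IsProbabilityMeasure toMeasure
  moment_lt_top : ∫⁻ x, ‖x‖ₑ ^ p ∂toMeasure < ∞

/-- `P_p(X)` carries the topology of the `W_p`-metric. -/
instance WassersteinSpace.instTopologicalSpace (p : ℝ) (X : Type*) [NormedAddCommGroup X]
    [MeasurableSpace X] : TopologicalSpace (WassersteinSpace p X) :=
  topologyOfDist fun μ ν => wassersteinDist p μ.toMeasure ν.toMeasure

/-! ### Fibred Wasserstein spaces -/

section Fibred

variable {Ω X : Type*} [MeasurableSpace Ω] [NormedAddCommGroup X] [MeasurableSpace X]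
  [StandardBorelSpace X]

/-- The space `P_{π,p}(Ω × X)` of probability measures on `Ω × X` with first marginal `π` and
finite fibred moment of order `p`. The disintegration of a measure `μ` against its first marginal
is `ω ↦ μ.condKernel ω`. -/
@[ext]
structure FibredWassersteinSpace (p : ℝ) (π : Measure Ω) (X : Type*) [NormedAddCommGroup X]
    [MeasurableSpace X] [StandardBorelSpace X] where
  toMeasure : Measure (Ω × X)
  isProb : IsProbabilityMeasure toMeasure
  fst_eq : toMeasure.map Prod.fst = π
  moment_lt_top : ∫⁻ ω, ∫⁻ x, ‖x‖ₑ ^ p ∂(toMeasure.condKernel ω) ∂π < ∞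

namespace FibredWassersteinSpace

variable {p : ℝ} {π : Measure Ω}

/-- The disintegration `ω ↦ μ_ω` of `μ` against `π`. -/
def fibre (μ : FibredWassersteinSpace p π X) : Kernel Ω X :=
  haveI := μ.isProb
  μ.toMeasure.condKernel

instance (μ : FibredWassersteinSpace p π X) : IsMarkovKernel μ.fibre := by
  have := μ.isProb
  unfold fibre
  infer_instance

theorem isProbabilityMeasure_base (μ : FibredWassersteinSpace p π X) :
    IsProbabilityMeasure π := by
  have := μ.isProb
  rw [← μ.fst_eq]
  exact Measure.isProbabilityMeasure_map measurable_fst.aemeasurable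

theorem moment_fibre_lt_top (μ : FibredWassersteinSpace p π X) :
    ∫⁻ ω, ∫⁻ x, ‖x‖ₑ ^ p ∂(μ.fibre ω) ∂π < ∞ := μ.moment_lt_top

/-- The fibred Wasserstein distance `W_{π,p}(μ, ν) = (∫ W_p(μ_ω, ν_ω)^p dπ(ω))^{1/p}`. -/
def fibredDist (μ ν : FibredWassersteinSpace p π X) : ℝ≥0∞ :=
  (∫⁻ ω, wassersteinDist p (μ.fibre ω) (ν.fibre ω) ^ p ∂π) ^ (1 / p)

/-- `P_{π,p}(Ω × X)` carries the topology of the `W_{π,p}`-metric. -/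
instance instTopologicalSpace : TopologicalSpace (FibredWassersteinSpace p π X) :=
  topologyOfDist fibredDist

variable [BorelSpace X]

/-- The average `(1 / π(A)) ∫_A μ_ω dπ(ω)` of the fibres of `μ` over a set `A` of positive measure.
Here `cond π A` is the measure `π(A)⁻¹ • π.restrict A`. -/
def average (μ : FibredWassersteinSpace p π X) (A : Set Ω) (hA : 0 < π A) :
    WassersteinSpace p X where
  toMeasure := (cond π A).bind μ.fibre
  isProb := by
    have := μ.isProbabilityMeasure_base
    have := cond_isProbabilityMeasure hA.ne'
    infer_instance
  moment_lt_top := by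
    rw [Measure.lintegral_bind μ.fibre.measurable.aemeasurable (by fun_prop), ProbabilityTheory.cond,
      lintegral_smul_measure]
    exact ENNReal.mul_lt_top (ENNReal.inv_lt_top.2 hA)
      ((lintegral_mono' Measure.restrict_le_self le_rfl).trans_lt μ.moment_fibre_lt_top)

end FibredWassersteinSpace

/-- A finite partition of `Ω` into pairwise disjoint sets of positive measure, each belonging to the
completion of the σ-algebra with respect to `π`. -/
structure FinitePositivePartition (π : Measure Ω) where
  n : ℕ
  part : Fin n → Set Ω
  nullMeasurableSet : ∀ i, NullMeasurableSet (part i) π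
  pos : ∀ i, 0 < π (part i)
  pairwiseDisjoint : Pairwise fun i j => Disjoint (part i) (part j)
  iUnion_eq : ⋃ i, part i = Set.univ

theorem FinitePositivePartition.sum_restrict {π : Measure Ω} (P : FinitePositivePartition π) :
    ∑ i, π.restrict (P.part i) = π := by
  rw [← Measure.sum_fintype, ← Measure.restrict_iUnion_ae
    (fun i j hij => (P.pairwiseDisjoint hij).aedisjoint) P.nullMeasurableSet, P.iUnion_eq,
    Measure.restrict_univ]

namespace FibredWassersteinSpace

variable {p : ℝ} {π : Measure Ω} [BorelSpace X]

/-- The measure `∫ ∑ i, (average of μ over A i) 𝟙_{A i}(ω) dπ(ω)` on `Ω × X`, that is, the sum over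
`i` of the products of `π.restrict (A i)` with the average of the fibres of `μ` over `A i`. -/
def condExpMeasure (μ : FibredWassersteinSpace p π X) (P : FinitePositivePartition π) :
    Measure (Ω × X) :=
  ∑ i, (π.restrict (P.part i)).prod (μ.average (P.part i) (P.pos i)).toMeasure

theorem condExpMeasure_fst (μ : FibredWassersteinSpace p π X) (P : FinitePositivePartition π) :
    (μ.condExpMeasure P).map Prod.fst = π := by
  have := μ.isProbabilityMeasure_base
  have := fun i => (μ.average (P.part i) (P.pos i)).isProb
  rw [condExpMeasure, Measure.map_finset_sum measurable_fst.aemeasurable]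
  conv_rhs => rw [← P.sum_restrict]
  refine Finset.sum_congr rfl fun i _ => ?_
  rw [Measure.map_fst_prod, measure_univ, one_smul]

theorem isProbabilityMeasure_condExpMeasure (μ : FibredWassersteinSpace p π X)
    (P : FinitePositivePartition π) : IsProbabilityMeasure (μ.condExpMeasure P) := by
  have := μ.isProbabilityMeasure_base
  constructor
  rw [← Set.preimage_univ (f := Prod.fst), ← Measure.map_apply measurable_fst MeasurableSet.univ,
    μ.condExpMeasure_fst P, measure_univ]

/-- The conditional expectation `E_P[μ]` of `μ` with respect to the finite partition `P`. -/
def condExp (μ : FibredWassersteinSpace p π X) (P : FinitePositivePartition π) :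
    FibredWassersteinSpace p π X where
  toMeasure := μ.condExpMeasure P
  isProb := μ.isProbabilityMeasure_condExpMeasure P
  fst_eq := μ.condExpMeasure_fst P
  moment_lt_top := by
    have := μ.isProbabilityMeasure_base
    have := fun i => (μ.average (P.part i) (P.pos i)).isProb
    have := μ.isProbabilityMeasure_condExpMeasure P
    have hm : Measurable fun z : Ω × X => ‖z.2‖ₑ ^ p := by fun_prop
    have h := Measure.lintegral_condKernel (ρ := μ.condExpMeasure P) hm
    rw [Measure.fst, μ.condExpMeasure_fst P] at h
    refine h.trans_lt ?_
    rw [condExpMeasure, lintegral_finsetSum_measure]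
    refine ENNReal.sum_lt_top.2 fun i _ => ?_
    rw [lintegral_prod _ hm.aemeasurable]
    dsimp only
    rw [lintegral_const]
    exact ENNReal.mul_lt_top (μ.average (P.part i) (P.pos i)).moment_lt_top (measure_lt_top _ _)

end FibredWassersteinSpace

end Fibred

end

/-!
Write `W` for the Wasserstein distance and `D` for the fibred one. The statement is the
characterisation of relatively compact sets in a complete metric space as the totally bounded ones,
once `P_{π,p}(Ω × X)` is seen as a space of `Lᵖ` maps `ω ↦ μ_ω` with values in the complete metric
space `P_p(X)`. Three facts carry this point of view.

* *Simple kernels are dense* (`SimplyApproximable.of_moment`). The space `X` is replaced by finitely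
  many points, the resulting weights by simple functions below them, and the missing mass is put at
  the origin. Each step is accompanied by an explicit measurable family of transport plans, so no
  measurable selection of optimal plans is needed. As a consequence, `ω ↦ W(μ_ω, ν_ω)` is almost
  everywhere measurable, which gives the triangle inequality for `D`, and `W` is convex:
  `W(∫ μ_ω dρ, ∫ ν_ω dρ) ≤ (∫ W(μ_ω, ν_ω)^p dρ)^{1/p}` (`wassersteinDist_bind_le`), since for simple
  kernels one chooses nearly optimal plans among finitely many.
* *Completeness* (`FibredWassersteinSpace.completeSpace`). A sequence of measures with summable
  consecutive distances is realised by one random sequence, a Markov chain obtained from the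
  Ionescu-Tulcea theorem, which converges almost surely and in `Lᵖ`; the law of its limit is the
  limit of the sequence (`exists_wassersteinDist_limit`). This is applied to almost every fibre. The
  convergence is also weak, so the limit kernel is measurable.
* *Conditional expectations*. By convexity, averages are Lipschitz and conditional expectations are
  contractions, and a kernel that is constant on the parts of `P` satisfies
  `D(s, E_P[μ]) ≤ D(s, μ)`. So each `μ` is close to `E_P[μ]` as soon as `P` is adapted to a simple
  kernel close to `μ`, and one `P` serves finitely many `μ`.

If `K` is relatively compact, (i) follows from the continuity of averages, and (ii) from a finite
net of `K` and the contraction property. Conversely `D(E_P[μ], E_P[ν])` is at most the maximum of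
the distances between the averages of `μ` and `ν` over the parts, so (i) makes `E_P[K]` totally
bounded, (ii) makes `K` totally bounded, and completeness concludes.
-/

open Filter Topology
open scoped NNReal BoundedContinuousFunction

/-! ### The topology of an extended pseudo-distance -/

theorem nhds_basis_topologyOfDist {α : Type*} {d : α → α → ℝ≥0∞} (h_self : ∀ x, d x x = 0)
    (h_comm : ∀ x y, d x y = d y x) (h_triangle : ∀ x y z, d x z ≤ d x y + d y z) (x : α) :
    (@nhds α (topologyOfDist d) x).HasBasis (fun c => 0 < c) fun c => {y | d x y < c} := by
  let _ := topologyOfDist d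
  refine ⟨fun t => ?_⟩
  rw [mem_nhds_iff]
  constructor
  · rintro ⟨U, hUt, hU, hx⟩
    obtain ⟨ε, hε, h⟩ := hU x hx
    exact ⟨ε, hε, fun y hy => hUt (h y (by rw [h_comm]; exact hy))⟩
  · rintro ⟨ε, hε, h⟩
    refine ⟨{y | d x y < ε}, h, fun y hy => ?_, by simpa [h_self] using hε⟩
    refine ⟨ε - d x y, tsub_pos_of_lt hy, fun z hz => ?_⟩
    have h1 : d x z ≤ d x y + d z y := by
      rw [h_comm z y]; exact h_triangle x y z
    exact h1.trans_lt (by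
      rw [add_comm]
      exact lt_tsub_iff_right.1 hz)

/-- An extended pseudo-distance `d` makes `α` an extended pseudo-metric space whose topology is, by
definition, `topologyOfDist d`. -/
@[reducible]
noncomputable def pseudoEMetricSpaceOfDist {α : Type*} (d : α → α → ℝ≥0∞)
    (h_self : ∀ x, d x x = 0) (h_comm : ∀ x y, d x y = d y x)
    (h_triangle : ∀ x y z, d x z ≤ d x y + d y z) : PseudoEMetricSpace α :=
  letI := topologyOfDist d
  PseudoEMetricSpace.ofEDistOfTopology d h_self h_comm h_triangle
    (nhds_basis_topologyOfDist h_self h_comm h_triangle)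

/-- A set is totally bounded as soon as, up to an arbitrarily small error, distances between its
points are controlled by distances between points of a totally bounded set. -/
theorem totallyBounded_of_edist_le {α : Type*} [PseudoEMetricSpace α] {s : Set α}
    (h : ∀ ε : ℝ≥0∞, 0 < ε → ∃ (β : Type*) (_ : PseudoEMetricSpace β) (Φ : α → β),
      TotallyBounded (Φ '' s) ∧ ∀ x ∈ s, ∀ y ∈ s, edist x y ≤ ε + edist (Φ x) (Φ y)) :
    TotallyBounded s := by
  obtain rfl | ⟨x₀, -⟩ := s.eq_empty_or_nonempty
  · exact totallyBounded_empty
  have : Nonempty α := ⟨x₀⟩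
  rw [EMetric.totallyBounded_iff]
  intro ε hε
  -- The truncation keeps the strict inequality below meaningful when `ε = ∞`.
  have hδ : 0 < min ε 1 / 2 := ENNReal.half_pos (lt_min hε one_pos).ne'
  have hδ_top : min ε 1 / 2 ≠ ∞ :=
    (ENNReal.div_lt_top (ne_top_of_le_ne_top ENNReal.one_ne_top (min_le_right _ _)) two_ne_zero).ne
  obtain ⟨β, _, Φ, hΦ, hle⟩ := h _ hδ
  obtain ⟨t, hts, htf, hst⟩ := EMetric.totallyBounded_iff'.1 hΦ _ hδ
  have hts' : ∀ y ∈ t, ∃ x ∈ s, Φ x = y := fun y hy => hts hy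
  choose! g hgs hg using hts'
  refine ⟨g '' t, htf.image g, fun x hx => ?_⟩
  obtain ⟨y, hy, hxy⟩ := Set.mem_iUnion₂.1 (hst ⟨x, hx, rfl⟩)
  refine Set.mem_iUnion₂.2 ⟨g y, ⟨y, hy, rfl⟩, ?_⟩
  rw [Metric.mem_eball] at hxy ⊢
  rw [← hg y hy] at hxy
  calc edist x (g y) ≤ min ε 1 / 2 + edist (Φ x) (Φ (g y)) := hle _ hx _ (hgs y hy)
    _ < min ε 1 / 2 + min ε 1 / 2 := ENNReal.add_lt_add_of_le_of_lt hδ_top le_rfl hxy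
    _ ≤ ε := (ENNReal.add_halves _).trans_le (min_le_left _ _)

/-! ### Transport plans -/

section Plans

variable {X : Type*} [MeasurableSpace X]

theorem transportPlans_swap {μ ν : Measure X} {γ : Measure (X × X)}
    (h : γ ∈ transportPlans μ ν) : γ.map Prod.swap ∈ transportPlans ν μ := by
  obtain ⟨h1, h2, h3⟩ := h
  refine ⟨Measure.isProbabilityMeasure_map measurable_swap.aemeasurable, ?_, ?_⟩
  · rw [Measure.map_map measurable_fst measurable_swap]; exact h3
  · rw [Measure.map_map measurable_snd measurable_swap]; exact h2

theorem map_prodMk_mem_transportPlans {Ω : Type*} [MeasurableSpace Ω] (P : Measure Ω)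
    [IsProbabilityMeasure P] {f g : Ω → X} (hf : Measurable f) (hg : Measurable g) :
    P.map (fun a => (f a, g a)) ∈ transportPlans (P.map f) (P.map g) := by
  refine ⟨Measure.isProbabilityMeasure_map (hf.prodMk hg).aemeasurable, ?_, ?_⟩
  · rw [Measure.map_map measurable_fst (hf.prodMk hg)]; rfl
  · rw [Measure.map_map measurable_snd (hf.prodMk hg)]; rfl

/-- If `y` is sampled from `κ (f ω)` with `ω` of law `P`, the law of `(f ω, y)` depends on `P` only
through the law of `f`. -/
theorem compProd_comap_map {Ω Y : Type*} [MeasurableSpace Ω] [MeasurableSpace Y]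
    (P : Measure Ω) [IsProbabilityMeasure P] (κ : Kernel X Y) [IsMarkovKernel κ] {f : Ω → X}
    (hf : Measurable f) :
    (P ⊗ₘ κ.comap f hf).map (Prod.map f id) = P.map f ⊗ₘ κ := by
  have : IsProbabilityMeasure (P.map f) := Measure.isProbabilityMeasure_map hf.aemeasurable
  ext s hs
  rw [Measure.map_apply (by fun_prop) hs, Measure.compProd_apply (by measurability),
    Measure.compProd_apply hs, lintegral_map (Kernel.measurable_kernel_prodMk_left hs) hf]
  rfl

variable [StandardBorelSpace X] [Nonempty X]

/-- Gluing: a random variable with the first marginal of a transport plan `γ` can be completed,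
using the disintegration of `γ`, to a pair of random variables with law `γ`. -/
theorem map_compProd_condKernel {Ω : Type*} [MeasurableSpace Ω] (P : Measure Ω)
    [IsProbabilityMeasure P] {f : Ω → X} (hf : Measurable f) {ν ρ : Measure X} (hfν : P.map f = ν)
    {γ : Measure (X × X)} [IsProbabilityMeasure γ] (hγ : γ ∈ transportPlans ν ρ) :
    (P ⊗ₘ γ.condKernel.comap f hf).map (Prod.map f id) = γ := by
  rw [compProd_comap_map, hfν, ← hγ.2.1]
  exact γ.disintegrate γ.condKernel

end Plans

/-! ### The Wasserstein distance -/

section Wasserstein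

variable {X : Type*} [MeasurableSpace X] [PseudoEMetricSpace X] {p : ℝ}

theorem wassersteinDist_le_of_mem {μ ν : Measure X} {γ : Measure (X × X)}
    (h : γ ∈ transportPlans μ ν) :
    wassersteinDist p μ ν ≤ (∫⁻ z, edist z.1 z.2 ^ p ∂γ) ^ (1 / p) :=
  iInf₂_le γ h

theorem exists_mem_transportPlans_lt {μ ν : Measure X} {r : ℝ≥0∞}
    (h : wassersteinDist p μ ν < r) :
    ∃ γ ∈ transportPlans μ ν, (∫⁻ z, edist z.1 z.2 ^ p ∂γ) ^ (1 / p) < r := by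
  simpa [wassersteinDist, iInf_lt_iff] using h

theorem wassersteinDist_map_le {Ω : Type*} [MeasurableSpace Ω] (hp : 0 ≤ p) (P : Measure Ω)
    [IsProbabilityMeasure P] {f g : Ω → X} (hf : Measurable f) (hg : Measurable g) :
    wassersteinDist p (P.map f) (P.map g) ≤ (∫⁻ a, edist (f a) (g a) ^ p ∂P) ^ (1 / p) := by
  refine (wassersteinDist_le_of_mem (map_prodMk_mem_transportPlans P hf hg)).trans ?_
  exact ENNReal.rpow_le_rpow (lintegral_map_le _ _) (by positivity)

theorem wassersteinDist_self (hp : 0 < p) (μ : Measure X) [IsProbabilityMeasure μ] :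
    wassersteinDist p μ μ = 0 := by
  have h := wassersteinDist_map_le hp.le μ measurable_id measurable_id
  simpa [hp, Measure.map_id] using h

variable [OpensMeasurableSpace X] [SecondCountableTopology X]

theorem wassersteinDist_comm (p : ℝ) (μ ν : Measure X) :
    wassersteinDist p μ ν = wassersteinDist p ν μ := by
  have key : ∀ μ ν : Measure X, wassersteinDist p μ ν ≤ wassersteinDist p ν μ := fun μ ν =>
    le_iInf₂ fun γ hγ => (wassersteinDist_le_of_mem (transportPlans_swap hγ)).trans_eq <| by
      rw [lintegral_map (by fun_prop) measurable_swap]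
      simp only [Prod.fst_swap, Prod.snd_swap, edist_comm]
  exact le_antisymm (key _ _) (key _ _)

theorem wassersteinDist_triangle [StandardBorelSpace X] [Nonempty X] (hp : 1 ≤ p)
    (μ ν ρ : Measure X) :
    wassersteinDist p μ ρ ≤ wassersteinDist p μ ν + wassersteinDist p ν ρ := by
  have h0 : 0 ≤ p := by linarith
  simp only [wassersteinDist]
  refine ENNReal.le_of_forall_pos_le_add fun ε hε hlt => ?_
  have hε' : (ε : ℝ≥0∞) / 2 ≠ 0 := by simpa using hε.ne'
  obtain ⟨γ₁, hγ₁, hc₁⟩ := exists_mem_transportPlans_lt (p := p) (μ := μ) (ν := ν)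
    (ENNReal.lt_add_right (ne_top_of_le_ne_top hlt.ne le_self_add) hε')
  obtain ⟨γ₂, hγ₂, hc₂⟩ := exists_mem_transportPlans_lt (p := p) (μ := ν) (ν := ρ)
    (ENNReal.lt_add_right (ne_top_of_le_ne_top hlt.ne le_add_self) hε')
  have := hγ₁.1
  have := hγ₂.1
  have hglue := map_compProd_condKernel γ₁ measurable_snd hγ₁.2.2 hγ₂
  set P := γ₁ ⊗ₘ γ₂.condKernel.comap Prod.snd measurable_snd with hP
  have hP₁ : P.map Prod.fst = γ₁ := Measure.fst_compProd _ _
  have hμ : P.map (fun z => z.1.1) = μ := by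
    rw [← hγ₁.2.1, ← hP₁, Measure.map_map (by fun_prop) (by fun_prop)]
    rfl
  have hρ : P.map (fun z => z.2) = ρ := by
    rw [← hγ₂.2.2, ← hglue, Measure.map_map (by fun_prop) (by fun_prop)]
    rfl
  have key := wassersteinDist_map_le h0 P (f := fun z => z.1.1) (g := fun z => z.2) (by fun_prop)
    (by fun_prop)
  rw [hμ, hρ] at key
  have e₁ : ∫⁻ z, edist z.1.1 z.1.2 ^ p ∂P = ∫⁻ z, edist z.1 z.2 ^ p ∂γ₁ := by
    conv_rhs => rw [← hP₁, lintegral_map (by fun_prop) (by fun_prop)]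
  have e₂ : ∫⁻ z, edist z.1.2 z.2 ^ p ∂P = ∫⁻ z, edist z.1 z.2 ^ p ∂γ₂ := by
    conv_rhs => rw [← hglue, lintegral_map (by fun_prop) (by fun_prop)]
    rfl
  calc wassersteinDist p μ ρ ≤ (∫⁻ z, edist z.1.1 z.2 ^ p ∂P) ^ (1 / p) := key
    _ ≤ (∫⁻ z, (edist z.1.1 z.1.2 + edist z.1.2 z.2) ^ p ∂P) ^ (1 / p) := by
      gcongr
      exact edist_triangle _ _ _
    _ ≤ (∫⁻ z, edist z.1.1 z.1.2 ^ p ∂P) ^ (1 / p) + (∫⁻ z, edist z.1.2 z.2 ^ p ∂P) ^ (1 / p) :=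
      ENNReal.lintegral_Lp_add_le (f := fun z : (X × X) × X => edist z.1.1 z.1.2)
        (g := fun z : (X × X) × X => edist z.1.2 z.2) (by fun_prop) (by fun_prop) hp
    _ ≤ (wassersteinDist p μ ν + ε / 2) + (wassersteinDist p ν ρ + ε / 2) := by
      rw [e₁, e₂]
      exact add_le_add hc₁.le hc₂.le
    _ = wassersteinDist p μ ν + wassersteinDist p ν ρ + ε := by
      rw [add_add_add_comm, ENNReal.add_halves]

end Wasserstein

/-! ### Preliminaries on integrals and simple functions -/

/-- On a probability space the `L¹` norm is at most the `Lᵖ` norm. -/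
theorem lintegral_le_lintegral_rpow {Ω : Type*} [MeasurableSpace Ω] {ρ : Measure Ω}
    [IsProbabilityMeasure ρ] {p : ℝ} (hp : 1 ≤ p) {g : Ω → ℝ≥0∞} (hg : AEMeasurable g ρ) :
    ∫⁻ ω, g ω ∂ρ ≤ (∫⁻ ω, g ω ^ p ∂ρ) ^ (1 / p) := by
  have h := eLpNorm'_le_eLpNorm'_of_exponent_le one_pos hp ρ hg.aestronglyMeasurable
  simpa [eLpNorm'] using h

/-- If the `Lᵖ` norms of a sequence are summable then its sum is almost everywhere finite. -/
theorem ae_tsum_lt_top {Ω : Type*} [MeasurableSpace Ω] {ρ : Measure Ω}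
    [IsProbabilityMeasure ρ] {p : ℝ} (hp : 1 ≤ p) {g : ℕ → Ω → ℝ≥0∞}
    (hg : ∀ n, AEMeasurable (g n) ρ) {δ : ℕ → ℝ≥0∞} (hδ : ∑' n, δ n ≠ ∞)
    (hle : ∀ n, (∫⁻ ω, g n ω ^ p ∂ρ) ^ (1 / p) ≤ δ n) :
    ∀ᵐ ω ∂ρ, ∑' n, g n ω < ∞ := by
  refine ae_lt_top' (AEMeasurable.tsum hg) ?_
  rw [lintegral_tsum hg]
  exact ne_top_of_le_ne_top hδ
    (ENNReal.tsum_le_tsum fun n => (lintegral_le_lintegral_rpow hp (hg n)).trans (hle n))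

/-- A finite family of simple functions, as a simple function with values in a product. -/
def simpleFuncPi {Ω ι : Type*} [MeasurableSpace Ω] [Finite ι] {β : ι → Type*}
    (s : ∀ i, SimpleFunc Ω (β i)) : SimpleFunc Ω (∀ i, β i) where
  toFun ω i := s i ω
  measurableSet_fiber' x := by
    have : (fun ω i => s i ω) ⁻¹' {x} = ⋂ i, s i ⁻¹' {x i} := by
      ext ω
      simp [funext_iff]
    rw [this]
    exact MeasurableSet.iInter fun i => (s i).measurableSet_fiber (x i)
  finite_range' := by
    refine (Set.Finite.pi' fun i => (s i).finite_range).subset ?_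
    rintro _ ⟨ω, rfl⟩ i
    exact ⟨ω, rfl⟩

theorem measure_map_bind {Ω X Y : Type*} [MeasurableSpace Ω] [MeasurableSpace X] [MeasurableSpace Y]
    (ρ : Measure Ω) {κ : Ω → Measure X} (hκ : Measurable κ) {f : X → Y} (hf : Measurable f) :
    (ρ.bind κ).map f = ρ.bind fun ω => (κ ω).map f := by
  ext s hs
  rw [Measure.map_apply hf hs, Measure.bind_apply (hf hs) hκ.aemeasurable,
    Measure.bind_apply (m := ρ) (f := fun ω => (κ ω).map f) hs
      ((Measure.measurable_map f hf).comp hκ).aemeasurable]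
  simp_rw [Measure.map_apply hf hs]

theorem isProbabilityMeasure_bind {Ω X : Type*} [MeasurableSpace Ω] [MeasurableSpace X]
    (ρ : Measure Ω) [IsProbabilityMeasure ρ] {κ : Ω → Measure X} (hκ : Measurable κ)
    [∀ ω, IsProbabilityMeasure (κ ω)] : IsProbabilityMeasure (ρ.bind κ) := by
  constructor
  rw [Measure.bind_apply MeasurableSet.univ hκ.aemeasurable]
  simp

theorem bind_mem_transportPlans {Ω X : Type*} [MeasurableSpace Ω] [MeasurableSpace X]
    (ρ : Measure Ω) [IsProbabilityMeasure ρ] {κ κ' : Ω → Measure X} {η : Ω → Measure (X × X)}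
    (hη : Measurable η) (h : ∀ ω, η ω ∈ transportPlans (κ ω) (κ' ω)) :
    ρ.bind η ∈ transportPlans (ρ.bind κ) (ρ.bind κ') := by
  have := fun ω => (h ω).1
  refine ⟨isProbabilityMeasure_bind ρ hη, ?_, ?_⟩
  · rw [measure_map_bind ρ hη measurable_fst]
    congr 1 with ω : 1
    exact (h ω).2.1
  · rw [measure_map_bind ρ hη measurable_snd]
    congr 1 with ω : 1
    exact (h ω).2.2

/-! ### Approximation of kernels by simple kernels -/

section Close

variable {Ω X : Type*} [MeasurableSpace Ω] [NormedAddCommGroup X] [CompleteSpace X]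
  [SeparableSpace X] [MeasurableSpace X] [BorelSpace X] {p : ℝ}

/-- Two kernels are `δ`-close over `ρ` when the Wasserstein distance of their fibres is dominated by
a measurable function of `Lᵖ(ρ)` norm at most `δ`, and the averages of the two kernels over `ρ` are
at distance at most `δ`. Measurable families of transport plans provide close kernels. -/
def KernelClose (p : ℝ) (ρ : Measure Ω) (κ κ' : Ω → Measure X) (δ : ℝ≥0∞) : Prop :=
  ∃ g : Ω → ℝ≥0∞, Measurable g ∧ (∀ ω, wassersteinDist p (κ ω) (κ' ω) ≤ g ω) ∧
    (∫⁻ ω, g ω ^ p ∂ρ) ^ (1 / p) ≤ δ ∧ wassersteinDist p (ρ.bind κ) (ρ.bind κ') ≤ δ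

omit [CompleteSpace X] [SeparableSpace X] [BorelSpace X] in
theorem KernelClose.mono {ρ : Measure Ω} {κ κ' : Ω → Measure X} {δ δ' : ℝ≥0∞}
    (h : KernelClose p ρ κ κ' δ) (hδ : δ ≤ δ') : KernelClose p ρ κ κ' δ' := by
  obtain ⟨g, h1, h2, h3, h4⟩ := h
  exact ⟨g, h1, h2, h3.trans hδ, h4.trans hδ⟩

theorem KernelClose.of_plan (hp : 0 < p) (ρ : Measure Ω) [IsProbabilityMeasure ρ]
    {κ κ' : Ω → Measure X} {η : Ω → Measure (X × X)} (hη : Measurable η)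
    (h : ∀ ω, η ω ∈ transportPlans (κ ω) (κ' ω)) :
    KernelClose p ρ κ κ' ((∫⁻ ω, ∫⁻ z, edist z.1 z.2 ^ p ∂η ω ∂ρ) ^ (1 / p)) := by
  refine ⟨fun ω => (∫⁻ z, edist z.1 z.2 ^ p ∂η ω) ^ (1 / p), ?_,
    fun ω => wassersteinDist_le_of_mem (h ω), ?_, ?_⟩
  · exact ((Measure.measurable_lintegral (by fun_prop)).comp hη).pow_const _
  · simp_rw [← ENNReal.rpow_mul, one_div, inv_mul_cancel₀ hp.ne', ENNReal.rpow_one]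
    rfl
  · refine (wassersteinDist_le_of_mem (bind_mem_transportPlans ρ hη h)).trans_eq ?_
    rw [Measure.lintegral_bind hη.aemeasurable (by fun_prop)]

theorem KernelClose.trans (hp : 1 ≤ p) {ρ : Measure Ω} {κ κ' κ'' : Ω → Measure X} {δ δ' : ℝ≥0∞}
    (h : KernelClose p ρ κ κ' δ) (h' : KernelClose p ρ κ' κ'' δ') :
    KernelClose p ρ κ κ'' (δ + δ') := by
  obtain ⟨g, h1, h2, h3, h4⟩ := h
  obtain ⟨g', h1', h2', h3', h4'⟩ := h'
  refine ⟨g + g', h1.add h1', fun ω => (wassersteinDist_triangle hp _ (κ' ω) _).trans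
    (add_le_add (h2 ω) (h2' ω)), ?_, (wassersteinDist_triangle hp _ (ρ.bind κ') _).trans
    (add_le_add h4 h4')⟩
  exact (ENNReal.lintegral_Lp_add_le h1.aemeasurable h1'.aemeasurable hp).trans (add_le_add h3 h3')

/-- A kernel is simply approximable over `ρ` when it is arbitrarily close to kernels with finitely
many values. -/
def SimplyApproximable (p : ℝ) (ρ : Measure Ω) (κ : Ω → Measure X) : Prop :=
  ∀ δ : ℝ≥0∞, 0 < δ → ∃ s : SimpleFunc Ω (Measure X),
    (∀ ω, IsProbabilityMeasure (s ω)) ∧ KernelClose p ρ κ s δ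

omit [CompleteSpace X] [SeparableSpace X] [BorelSpace X] in
theorem KernelClose.refl (hp : 0 < p) (ρ : Measure Ω) [IsProbabilityMeasure ρ]
    {κ : Ω → Measure X} (hκ : Measurable κ) [∀ ω, IsProbabilityMeasure (κ ω)] (δ : ℝ≥0∞) :
    KernelClose p ρ κ κ δ := by
  have := isProbabilityMeasure_bind ρ hκ
  refine ⟨0, measurable_const, fun ω => (wassersteinDist_self hp _).le, ?_,
    (wassersteinDist_self hp _).le.trans zero_le⟩
  simp [hp]

omit [CompleteSpace X] [SeparableSpace X] [BorelSpace X] in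
theorem SimplyApproximable.of_simpleFunc (hp : 0 < p) (ρ : Measure Ω) [IsProbabilityMeasure ρ]
    (s : SimpleFunc Ω (Measure X)) [hs : ∀ ω, IsProbabilityMeasure (s ω)] :
    SimplyApproximable p ρ s :=
  fun δ _ => ⟨s, hs, KernelClose.refl hp ρ s.measurable δ⟩

/-- A kernel of finite moment is close to kernels all of whose fibres are carried by a common finite
set: its points are moved to the nearest one among the first points of a dense sequence. -/
theorem exists_simpleFunc_map_close (hp : 1 ≤ p) (ρ : Measure Ω) [IsProbabilityMeasure ρ]
    {κ : Ω → Measure X} (hκ : Measurable κ) [∀ ω, IsProbabilityMeasure (κ ω)]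
    (hfin : ∫⁻ ω, ∫⁻ x, ‖x‖ₑ ^ p ∂κ ω ∂ρ ≠ ∞) {δ : ℝ≥0∞} (hδ : 0 < δ) :
    ∃ T : SimpleFunc X X, KernelClose p ρ κ (fun ω => (κ ω).map T) δ := by
  have hp0 : 0 < p := by linarith
  let T := fun n => SimpleFunc.approxOn (fun x : X => x) measurable_id Set.univ 0 trivial n
  have hplan : ∀ n ω, (κ ω).map (fun x => (x, T n x)) ∈
      transportPlans (κ ω) ((κ ω).map (T n)) := fun n ω => by
    have h := map_prodMk_mem_transportPlans (κ ω) (measurable_id (α := X)) (T n).measurable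
    rwa [Measure.map_id] at h
  have hm : ∀ n, Measurable fun x : X => (x, T n x) := fun n =>
    measurable_id.prodMk (T n).measurable
  have hclose := fun n => KernelClose.of_plan hp0 ρ
    ((Measure.measurable_map _ (hm n)).comp hκ) (hplan n)
  have hmeas : ∀ n, Measurable fun x : X => edist x (T n x) ^ p := fun n =>
    (measurable_id.edist (T n).measurable).pow_const _
  have hcost : ∀ n, ∫⁻ ω, ∫⁻ z, edist z.1 z.2 ^ p ∂((κ ω).map fun x => (x, T n x)) ∂ρ =
      ∫⁻ x, edist x (T n x) ^ p ∂(ρ.bind κ) := fun n => by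
    rw [Measure.lintegral_bind hκ.aemeasurable (hmeas n).aemeasurable]
    refine lintegral_congr fun ω => ?_
    rw [lintegral_map (by fun_prop) (hm n)]
  have hlim : Tendsto (fun n => (∫⁻ x, edist x (T n x) ^ p ∂(ρ.bind κ)) ^ (1 / p)) atTop (𝓝 0) := by
    have h0 : (0 : ℝ≥0∞) = (∫⁻ _, 0 ∂(ρ.bind κ)) ^ (1 / p) := by simp [hp0]
    rw [h0]
    refine (ENNReal.continuous_rpow_const.tendsto _).comp ?_
    refine tendsto_lintegral_of_dominated_convergence (fun x => ‖x‖ₑ ^ p) hmeas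
      (fun n => ae_of_all _ fun x => ?_) ?_ (ae_of_all _ fun x => ?_)
    · dsimp only
      gcongr
      rw [← edist_zero_right x, edist_comm x 0]
      rw [edist_comm]
      exact SimpleFunc.edist_approxOn_le (f := fun x : X => x) (s := Set.univ) measurable_id
        trivial x n
    · rw [Measure.lintegral_bind hκ.aemeasurable (by fun_prop)]
      exact hfin
    · have h1 : Tendsto (fun n => edist x (T n x)) atTop (𝓝 (edist x x)) :=
        tendsto_const_nhds.edist
          (SimpleFunc.tendsto_approxOn (f := fun x : X => x) (s := Set.univ) measurable_id trivial
            (by simp))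
      have h2 := (ENNReal.continuous_rpow_const (y := p)).tendsto (edist x x) |>.comp h1
      simpa [hp0, Function.comp_def] using h2
  obtain ⟨n, hn⟩ := (hlim.eventually_le_const hδ).exists
  refine ⟨T n, (hclose n).mono ?_⟩
  rw [Function.comp_def, hcost n]
  exact hn

/-- A kernel all of whose fibres are carried by a common finite set is simply approximable: the
weights are approximated from below by simple functions, and the missing mass is moved to `0`. -/
theorem SimplyApproximable.map_simpleFunc (hp : 1 ≤ p) (ρ : Measure Ω) [IsProbabilityMeasure ρ]
    {κ : Ω → Measure X} (hκ : Measurable κ) [∀ ω, IsProbabilityMeasure (κ ω)]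
    (T : SimpleFunc X X) : SimplyApproximable p ρ fun ω => (κ ω).map T := by
  intro δ hδ
  have hp0 : 0 < p := by linarith
  -- The weights of `(κ ω).map T`, and simple functions increasing to them.
  let a : T.range → Ω → ℝ≥0∞ := fun y ω => κ ω (T ⁻¹' {y.1})
  have ha : ∀ y, Measurable (a y) := fun y =>
    (Measure.measurable_coe (T.measurableSet_fiber y.1)).comp hκ
  have ha1 : ∀ y ω, a y ω ≤ 1 := fun y ω => prob_le_one
  let c : ℕ → T.range → SimpleFunc Ω ℝ≥0∞ := fun n y => SimpleFunc.eapprox (a y) n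
  have hca : ∀ n y ω, c n y ω ≤ a y ω := fun n y ω => by
    rw [← SimpleFunc.iSup_eapprox_apply (ha y) ω]
    exact le_iSup (fun n => SimpleFunc.eapprox (a y) n ω) n
  have hκa : ∀ ω, (κ ω).map T = ∑ y, a y ω • Measure.dirac y.1 := fun ω => by
    ext S hS
    have h1 := SimpleFunc.map_lintegral (S.indicator 1) T (μ := κ ω)
    rw [← SimpleFunc.lintegral_eq_lintegral] at h1
    rw [← lintegral_indicator_one hS, lintegral_map (measurable_one.indicator hS) T.measurable,
      Measure.finsetSum_apply]
    refine h1.trans ?_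
    rw [← Finset.sum_coe_sort]
    refine Finset.sum_congr rfl fun y _ => ?_
    rw [Measure.smul_apply, Measure.dirac_apply' _ hS, smul_eq_mul, mul_comm]
  -- The plan leaves the mass `c n y ω` at `y` and sends the rest of the mass at `y` to `0`.
  let η : ℕ → Ω → Measure (X × X) := fun n ω =>
    ∑ y, c n y ω • Measure.dirac (y.1, y.1) + ∑ y, (a y ω - c n y ω) • Measure.dirac (y.1, 0)
  let F : (T.range → ℝ≥0∞) → Measure X := fun w =>
    ∑ y, w y • Measure.dirac y.1 + (1 - ∑ y, w y) • Measure.dirac 0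
  let s : ℕ → SimpleFunc Ω (Measure X) := fun n => (simpleFuncPi (c n)).map F
  have hsum : ∀ ω, ∑ y, a y ω = 1 := fun ω => by
    have h : (κ ω).map T Set.univ = 1 := by
      have := Measure.isProbabilityMeasure_map (μ := κ ω) T.measurable.aemeasurable
      exact measure_univ
    simpa [hκa] using h
  have hη : ∀ n, Measurable (η n) := fun n => by
    refine Measure.measurable_of_measurable_coe _ fun S hS => ?_
    simp only [η, Measure.add_apply, Measure.finsetSum_apply, Measure.smul_apply, smul_eq_mul]
    have h1 : ∀ y, Measurable (c n y) := fun y => (c n y).measurable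
    fun_prop
  have hmass : ∀ n ω, ∑ y, (a y ω - c n y ω) = 1 - ∑ y, c n y ω := fun n ω => by
    rw [← hsum ω]
    refine ENNReal.eq_sub_of_add_eq ?_ ?_
    · exact ENNReal.sum_ne_top.2 fun y _ =>
        ne_top_of_le_ne_top ENNReal.one_ne_top ((hca n y ω).trans (ha1 y ω))
    · rw [← Finset.sum_add_distrib]
      exact Finset.sum_congr rfl fun y _ => tsub_add_cancel_of_le (hca n y ω)
  have hplan : ∀ n ω, η n ω ∈ transportPlans ((κ ω).map T) (s n ω) := fun n ω => by
    have hfst : (η n ω).map Prod.fst = (κ ω).map T := by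
      simp only [η]
      rw [Measure.map_add _ _ measurable_fst, Measure.map_finset_sum measurable_fst.aemeasurable,
        Measure.map_finset_sum measurable_fst.aemeasurable, hκa, ← Finset.sum_add_distrib]
      refine Finset.sum_congr rfl fun y _ => ?_
      rw [Measure.map_smul, Measure.map_smul, Measure.map_dirac' measurable_fst,
        Measure.map_dirac' measurable_fst, ← add_smul, add_tsub_cancel_of_le (hca n y ω)]
    refine ⟨⟨?_⟩, hfst, ?_⟩
    · have := Measure.isProbabilityMeasure_map (μ := κ ω) T.measurable.aemeasurable
      rw [← Set.preimage_univ (f := Prod.fst),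
        ← Measure.map_apply measurable_fst MeasurableSet.univ, hfst, measure_univ]
    · simp only [η]
      rw [Measure.map_add _ _ measurable_snd, Measure.map_finset_sum measurable_snd.aemeasurable,
        Measure.map_finset_sum measurable_snd.aemeasurable]
      simp only [Measure.map_smul, Measure.map_dirac' measurable_snd]
      rw [← Finset.sum_smul, hmass]
      rfl
  have hclose := fun n => KernelClose.of_plan hp0 ρ (hη n) (hplan n)
  have hcost : ∀ n ω, ∫⁻ z, edist z.1 z.2 ^ p ∂η n ω = ∑ y, (a y ω - c n y ω) * ‖y.1‖ₑ ^ p := by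
    intro n ω
    simp only [η]
    rw [lintegral_add_measure, lintegral_finsetSum_measure, lintegral_finsetSum_measure]
    have hm : Measurable fun z : X × X => edist z.1 z.2 ^ p := by fun_prop
    simp [lintegral_smul_measure, hp0, lintegral_dirac' _ hm]
  have hlim : Tendsto (fun n => (∫⁻ ω, ∫⁻ z, edist z.1 z.2 ^ p ∂η n ω ∂ρ) ^ (1 / p)) atTop
      (𝓝 0) := by
    have h0 : (0 : ℝ≥0∞) = (∫⁻ _, 0 ∂ρ) ^ (1 / p) := by simp [hp0]
    rw [h0]
    refine (ENNReal.continuous_rpow_const.tendsto _).comp ?_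
    simp only [hcost]
    refine tendsto_lintegral_of_dominated_convergence (fun _ => ∑ y : T.range, ‖y.1‖ₑ ^ p)
      (fun n => ?_) (fun n => ae_of_all _ fun ω => ?_) ?_ (ae_of_all _ fun ω => ?_)
    · have h1 : ∀ y, Measurable (c n y) := fun y => (c n y).measurable
      fun_prop
    · refine Finset.sum_le_sum fun y _ => ?_
      exact mul_le_of_le_one_left zero_le (tsub_le_self.trans (ha1 y ω))
    · rw [lintegral_const, measure_univ, mul_one]
      exact ENNReal.sum_ne_top.2 fun y _ => by simp [hp0.le]
    · rw [← Finset.sum_const_zero (s := (Finset.univ : Finset T.range))]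
      refine tendsto_finsetSum _ fun y _ => ?_
      have h1 : Tendsto (fun n => c n y ω) atTop (𝓝 (a y ω)) :=
        SimpleFunc.tendsto_eapprox (ha y) ω
      have h2 : Tendsto (fun n => a y ω - c n y ω) atTop (𝓝 (a y ω - a y ω)) :=
        ENNReal.Tendsto.sub tendsto_const_nhds h1
          (Or.inl (ne_top_of_le_ne_top ENNReal.one_ne_top (ha1 y ω)))
      have h3 := ENNReal.Tendsto.mul_const (b := ‖y.1‖ₑ ^ p) h2 (Or.inr (by simp [hp0.le]))
      simpa using h3
  obtain ⟨n, hn⟩ := (hlim.eventually_le_const hδ).exists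
  exact ⟨s n, fun ω => by
    have := (hplan n ω).1
    rw [← (hplan n ω).2.2]
    exact Measure.isProbabilityMeasure_map measurable_snd.aemeasurable, (hclose n).mono hn⟩

/-- Kernels of finite moment are simply approximable. -/
theorem SimplyApproximable.of_moment (hp : 1 ≤ p) (ρ : Measure Ω) [IsProbabilityMeasure ρ]
    {κ : Ω → Measure X} (hκ : Measurable κ) [∀ ω, IsProbabilityMeasure (κ ω)]
    (hfin : ∫⁻ ω, ∫⁻ x, ‖x‖ₑ ^ p ∂κ ω ∂ρ ≠ ∞) : SimplyApproximable p ρ κ := by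
  intro δ hδ
  obtain ⟨T, hT⟩ := exists_simpleFunc_map_close hp ρ hκ hfin (ENNReal.half_pos hδ.ne')
  obtain ⟨s, hs, hsT⟩ := SimplyApproximable.map_simpleFunc hp ρ hκ T _ (ENNReal.half_pos hδ.ne')
  refine ⟨s, hs, ?_⟩
  rw [← ENNReal.add_halves δ]
  exact hT.trans hp hsT

/-- The Wasserstein distance between the fibres of two simply approximable kernels is almost
everywhere measurable, as an almost everywhere limit of simple functions. -/
theorem SimplyApproximable.aemeasurable_wassersteinDist (hp : 1 ≤ p) {ρ : Measure Ω}
    [IsProbabilityMeasure ρ] {κ κ' : Ω → Measure X} (h : SimplyApproximable p ρ κ)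
    (h' : SimplyApproximable p ρ κ') :
    AEMeasurable (fun ω => wassersteinDist p (κ ω) (κ' ω)) ρ := by
  obtain ⟨δ, hδ, hδsum⟩ := ENNReal.exists_pos_sum_of_countable' one_ne_zero ℕ
  choose s hs g hg hle hgδ _ using fun n => h (δ n) (hδ n)
  choose s' hs' g' hg' hle' hgδ' _ using fun n => h' (δ n) (hδ n)
  have hδtop : ∑' n, δ n ≠ ∞ := (hδsum.trans ENNReal.one_lt_top).ne
  refine aemeasurable_of_tendsto_metrizable_ae atTop
    (f := fun n ω => ((s n).pair (s' n)).map (fun q => wassersteinDist p q.1 q.2) ω)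
    (fun n => (SimpleFunc.measurable _).aemeasurable) ?_
  filter_upwards [ae_tsum_lt_top hp (fun n => (hg n).aemeasurable) hδtop hgδ,
    ae_tsum_lt_top hp (fun n => (hg' n).aemeasurable) hδtop hgδ'] with ω h1 h2
  simp only [SimpleFunc.map_apply, SimpleFunc.pair_apply]
  have hlim : Tendsto (fun n => g n ω + g' n ω) atTop (𝓝 0) := by
    simpa using (ENNReal.tendsto_atTop_zero_of_tsum_ne_top h1.ne).add
      (ENNReal.tendsto_atTop_zero_of_tsum_ne_top h2.ne)
  have hlow := ENNReal.Tendsto.sub (tendsto_const_nhds (x := wassersteinDist p (κ ω) (κ' ω))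
    (f := (atTop : Filter ℕ))) hlim (Or.inr ENNReal.zero_ne_top)
  have hup := (tendsto_const_nhds (x := wassersteinDist p (κ ω) (κ' ω))
    (f := (atTop : Filter ℕ))).add hlim
  rw [tsub_zero] at hlow
  rw [add_zero] at hup
  refine tendsto_of_tendsto_of_tendsto_of_le_of_le hlow hup (fun n => ?_) (fun n => ?_)
  · refine tsub_le_iff_right.2 ?_
    calc wassersteinDist p (κ ω) (κ' ω)
        ≤ wassersteinDist p (κ ω) (s n ω) + wassersteinDist p (s n ω) (κ' ω) :=
          wassersteinDist_triangle hp _ _ _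
      _ ≤ g n ω + (wassersteinDist p (s n ω) (s' n ω) + wassersteinDist p (s' n ω) (κ' ω)) :=
          add_le_add (hle n ω) (wassersteinDist_triangle hp _ _ _)
      _ ≤ g n ω + (wassersteinDist p (s n ω) (s' n ω) + g' n ω) := by
          rw [wassersteinDist_comm p (s' n ω)]
          gcongr
          exact hle' n ω
      _ = wassersteinDist p (s n ω) (s' n ω) + (g n ω + g' n ω) := by ring
  · calc wassersteinDist p (s n ω) (s' n ω)
        ≤ wassersteinDist p (s n ω) (κ ω) + wassersteinDist p (κ ω) (s' n ω) :=
          wassersteinDist_triangle hp _ _ _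
      _ ≤ g n ω + (wassersteinDist p (κ ω) (κ' ω) + wassersteinDist p (κ' ω) (s' n ω)) := by
          rw [wassersteinDist_comm p (s n ω)]
          exact add_le_add (hle n ω) (wassersteinDist_triangle hp _ _ _)
      _ ≤ g n ω + (wassersteinDist p (κ ω) (κ' ω) + g' n ω) := by
          gcongr
          exact hle' n ω
      _ = wassersteinDist p (κ ω) (κ' ω) + (g n ω + g' n ω) := by ring

end Close

/-! ### Convexity of the Wasserstein distance -/

section Convexity

variable {Ω X : Type*} [MeasurableSpace Ω] [NormedAddCommGroup X] [CompleteSpace X]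
  [SeparableSpace X] [MeasurableSpace X] [BorelSpace X] {p : ℝ}

omit [CompleteSpace X] [SeparableSpace X] [BorelSpace X] in
theorem exists_mem_transportPlans_le (p : ℝ) (μ ν : Measure X) [IsProbabilityMeasure μ]
    [IsProbabilityMeasure ν] {ε : ℝ≥0∞} (hε : ε ≠ 0) :
    ∃ γ ∈ transportPlans μ ν,
      (∫⁻ z, edist z.1 z.2 ^ p ∂γ) ^ (1 / p) ≤ wassersteinDist p μ ν + ε := by
  obtain h | h := eq_or_ne (wassersteinDist p μ ν) ∞
  · refine ⟨μ.prod ν, ⟨inferInstance, ?_, ?_⟩, by simp [h]⟩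
    · simp [Measure.map_fst_prod]
    · simp [Measure.map_snd_prod]
  · obtain ⟨γ, hγ, hlt⟩ := exists_mem_transportPlans_lt (ENNReal.lt_add_right h hε)
    exact ⟨γ, hγ, hlt.le⟩

omit [CompleteSpace X] [SeparableSpace X] [BorelSpace X] in
/-- Nearly optimal transport plans between the fibres of two simple kernels can be chosen among
finitely many, hence measurably. -/
theorem exists_simpleFunc_transportPlans (p : ℝ) (s s' : SimpleFunc Ω (Measure X))
    (hs : ∀ ω, IsProbabilityMeasure (s ω)) (hs' : ∀ ω, IsProbabilityMeasure (s' ω))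
    {ε : ℝ≥0∞} (hε : ε ≠ 0) :
    ∃ η : SimpleFunc Ω (Measure (X × X)), ∀ ω, η ω ∈ transportPlans (s ω) (s' ω) ∧
      (∫⁻ z, edist z.1 z.2 ^ p ∂η ω) ^ (1 / p) ≤ wassersteinDist p (s ω) (s' ω) + ε := by
  have hex : ∀ q : Measure X × Measure X, ∃ γ, IsProbabilityMeasure q.1 →
      IsProbabilityMeasure q.2 → γ ∈ transportPlans q.1 q.2 ∧
      (∫⁻ z, edist z.1 z.2 ^ p ∂γ) ^ (1 / p) ≤ wassersteinDist p q.1 q.2 + ε := fun q => by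
    by_cases h : IsProbabilityMeasure q.1 ∧ IsProbabilityMeasure q.2
    · have := h.1
      have := h.2
      obtain ⟨γ, hγ⟩ := exists_mem_transportPlans_le p q.1 q.2 hε
      exact ⟨γ, fun _ _ => hγ⟩
    · exact ⟨0, fun h1 h2 => absurd ⟨h1, h2⟩ h⟩
  choose G hG using hex
  exact ⟨(s.pair s').map G, fun ω => hG (s ω, s' ω) (hs ω) (hs' ω)⟩

/-- Convexity of the Wasserstein distance for simple kernels. -/
theorem wassersteinDist_bind_simpleFunc_le (hp : 1 ≤ p) (ρ : Measure Ω) [IsProbabilityMeasure ρ]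
    (s s' : SimpleFunc Ω (Measure X)) (hs : ∀ ω, IsProbabilityMeasure (s ω))
    (hs' : ∀ ω, IsProbabilityMeasure (s' ω)) :
    wassersteinDist p (ρ.bind s) (ρ.bind s') ≤
      (∫⁻ ω, wassersteinDist p (s ω) (s' ω) ^ p ∂ρ) ^ (1 / p) := by
  have hp0 : 0 < p := by linarith
  refine ENNReal.le_of_forall_pos_le_add fun ε hε _ => ?_
  obtain ⟨η, hη⟩ := exists_simpleFunc_transportPlans p s s' hs hs'
    (ENNReal.coe_ne_zero.2 hε.ne')
  obtain ⟨_, -, -, -, h⟩ := KernelClose.of_plan hp0 ρ η.measurable fun ω => (hη ω).1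
  have hm : Measurable fun ω => wassersteinDist p (s ω) (s' ω) :=
    ((s.pair s').map fun q : Measure X × Measure X => wassersteinDist p q.1 q.2).measurable
  have h1 : ∀ ω, ∫⁻ z, edist z.1 z.2 ^ p ∂η ω ≤ (wassersteinDist p (s ω) (s' ω) + ε) ^ p :=
    fun ω => by
      have h1 := ENNReal.rpow_le_rpow (hη ω).2 hp0.le
      rwa [← ENNReal.rpow_mul, one_div, inv_mul_cancel₀ hp0.ne', ENNReal.rpow_one] at h1
  calc wassersteinDist p (ρ.bind s) (ρ.bind s')
      ≤ (∫⁻ ω, ∫⁻ z, edist z.1 z.2 ^ p ∂η ω ∂ρ) ^ (1 / p) := h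
    _ ≤ (∫⁻ ω, (wassersteinDist p (s ω) (s' ω) + ε) ^ p ∂ρ) ^ (1 / p) :=
      ENNReal.rpow_le_rpow (lintegral_mono h1) (by positivity)
    _ ≤ (∫⁻ ω, wassersteinDist p (s ω) (s' ω) ^ p ∂ρ) ^ (1 / p) +
        (∫⁻ _, (ε : ℝ≥0∞) ^ p ∂ρ) ^ (1 / p) :=
      ENNReal.lintegral_Lp_add_le (g := fun _ => (ε : ℝ≥0∞)) hm.aemeasurable aemeasurable_const hp
    _ = (∫⁻ ω, wassersteinDist p (s ω) (s' ω) ^ p ∂ρ) ^ (1 / p) + ε := by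
      rw [lintegral_const, measure_univ, mul_one, ← ENNReal.rpow_mul, mul_one_div_cancel hp0.ne',
        ENNReal.rpow_one]

/-- Convexity of the Wasserstein distance: the distance between the averages of two kernels is at
most the `Lᵖ` norm of the distance between their fibres. -/
theorem wassersteinDist_bind_le (hp : 1 ≤ p) (ρ : Measure Ω) [IsProbabilityMeasure ρ]
    {κ κ' : Ω → Measure X} (h : SimplyApproximable p ρ κ) (h' : SimplyApproximable p ρ κ') :
    wassersteinDist p (ρ.bind κ) (ρ.bind κ') ≤
      (∫⁻ ω, wassersteinDist p (κ ω) (κ' ω) ^ p ∂ρ) ^ (1 / p) := by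
  refine ENNReal.le_of_forall_pos_le_add fun ε hε _ => ?_
  have hε4 : 0 < (ε : ℝ≥0∞) / 2 / 2 :=
    ENNReal.half_pos (ENNReal.half_pos (by simpa using hε.ne')).ne'
  set δ := (ε : ℝ≥0∞) / 2 / 2 with hδ
  obtain ⟨s, hs, g, hg, hle, hgδ, hb⟩ := h δ hε4
  obtain ⟨s', hs', g', hg', hle', hgδ', hb'⟩ := h' δ hε4
  have hW := h.aemeasurable_wassersteinDist hp h'
  have hss : (∫⁻ ω, wassersteinDist p (s ω) (s' ω) ^ p ∂ρ) ^ (1 / p) ≤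
      δ + ((∫⁻ ω, wassersteinDist p (κ ω) (κ' ω) ^ p ∂ρ) ^ (1 / p) + δ) := by
    calc (∫⁻ ω, wassersteinDist p (s ω) (s' ω) ^ p ∂ρ) ^ (1 / p)
        ≤ (∫⁻ ω, (g ω + (wassersteinDist p (κ ω) (κ' ω) + g' ω)) ^ p ∂ρ) ^ (1 / p) := by
          gcongr with ω
          calc wassersteinDist p (s ω) (s' ω)
              ≤ wassersteinDist p (s ω) (κ ω) + wassersteinDist p (κ ω) (s' ω) :=
                wassersteinDist_triangle hp _ _ _
            _ ≤ g ω + (wassersteinDist p (κ ω) (κ' ω) + g' ω) := by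
                rw [wassersteinDist_comm p (s ω)]
                exact add_le_add (hle ω) ((wassersteinDist_triangle hp _ (κ' ω) _).trans
                  (add_le_add le_rfl (hle' ω)))
      _ ≤ (∫⁻ ω, g ω ^ p ∂ρ) ^ (1 / p) +
          (∫⁻ ω, (wassersteinDist p (κ ω) (κ' ω) + g' ω) ^ p ∂ρ) ^ (1 / p) :=
          ENNReal.lintegral_Lp_add_le (g := fun ω => wassersteinDist p (κ ω) (κ' ω) + g' ω)
            hg.aemeasurable (hW.add hg'.aemeasurable) hp
      _ ≤ δ + ((∫⁻ ω, wassersteinDist p (κ ω) (κ' ω) ^ p ∂ρ) ^ (1 / p) + δ) := by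
          refine add_le_add hgδ ((ENNReal.lintegral_Lp_add_le hW hg'.aemeasurable hp).trans ?_)
          exact add_le_add le_rfl hgδ'
  calc wassersteinDist p (ρ.bind κ) (ρ.bind κ')
      ≤ wassersteinDist p (ρ.bind κ) (ρ.bind s) + wassersteinDist p (ρ.bind s) (ρ.bind κ') :=
        wassersteinDist_triangle hp _ _ _
    _ ≤ δ + ((δ + ((∫⁻ ω, wassersteinDist p (κ ω) (κ' ω) ^ p ∂ρ) ^ (1 / p) + δ)) + δ) := by
        refine add_le_add hb ((wassersteinDist_triangle hp _ (ρ.bind s') _).trans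
          (add_le_add ((wassersteinDist_bind_simpleFunc_le hp ρ s s' hs hs').trans hss) ?_))
        rw [wassersteinDist_comm]
        exact hb'
    _ = (∫⁻ ω, wassersteinDist p (κ ω) (κ' ω) ^ p ∂ρ) ^ (1 / p) + ((δ + δ) + (δ + δ)) := by ring
    _ = (∫⁻ ω, wassersteinDist p (κ ω) (κ' ω) ^ p ∂ρ) ^ (1 / p) + ε := by
        rw [hδ, ENNReal.add_halves, ENNReal.add_halves]

end Convexity

/-! ### Limits of sequences of measures and of kernels -/


/-- Minkowski's inequality for countable sums. -/
theorem lintegral_tsum_rpow_le {Ω : Type*} [MeasurableSpace Ω] {ρ : Measure Ω} {p : ℝ} (hp : 1 ≤ p)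
    {g : ℕ → Ω → ℝ≥0∞} (hg : ∀ n, AEMeasurable (g n) ρ) :
    (∫⁻ ω, (∑' n, g n ω) ^ p ∂ρ) ^ (1 / p) ≤ ∑' n, (∫⁻ ω, g n ω ^ p ∂ρ) ^ (1 / p) := by
  have hp0 : 0 < p := by linarith
  have hfin : ∀ N, (∫⁻ ω, (∑ n ∈ Finset.range N, g n ω) ^ p ∂ρ) ^ (1 / p) ≤
      ∑ n ∈ Finset.range N, (∫⁻ ω, g n ω ^ p ∂ρ) ^ (1 / p) := fun N => by
    induction N with
    | zero => simp [hp0]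
    | succ N ih =>
      simp_rw [Finset.sum_range_succ]
      refine (ENNReal.lintegral_Lp_add_le (f := fun ω => ∑ n ∈ Finset.range N, g n ω)
        (Finset.aemeasurable_fun_sum _ fun n _ => hg n) (hg N) hp).trans ?_
      gcongr
  have hlim : Tendsto (fun N => (∫⁻ ω, (∑ n ∈ Finset.range N, g n ω) ^ p ∂ρ) ^ (1 / p)) atTop
      (𝓝 ((∫⁻ ω, (∑' n, g n ω) ^ p ∂ρ) ^ (1 / p))) := by
    refine (ENNReal.continuous_rpow_const.tendsto _).comp ?_
    refine lintegral_tendsto_of_tendsto_of_monotone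
      (fun N => (Finset.aemeasurable_fun_sum _ fun n _ => hg n).pow_const _)
      (ae_of_all _ fun ω N M hNM => ?_) (ae_of_all _ fun ω => ?_)
    · dsimp only
      gcongr
    · exact (ENNReal.continuous_rpow_const.tendsto _).comp (ENNReal.tendsto_nat_tsum _)
  exact le_of_tendsto' hlim fun N => (hfin N).trans (ENNReal.sum_le_tsum _)

/-- A sequence of transport plans between consecutive measures is realised by a single random
sequence, a Markov chain whose transition kernels are the disintegrations of the plans. -/
theorem exists_measure_map_pair_eq {X : Type*} [MeasurableSpace X] [StandardBorelSpace X]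
    [Nonempty X] {μ : ℕ → Measure X} {γ : ℕ → Measure (X × X)}
    (hγ : ∀ n, γ n ∈ transportPlans (μ n) (μ (n + 1))) :
    ∃ P : Measure (ℕ → X), IsProbabilityMeasure P ∧
      ∀ n, P.map (fun x => x n) = μ n ∧ P.map (fun x => (x n, x (n + 1))) = γ n := by
  have := fun n => (hγ n).1
  have : IsProbabilityMeasure (μ 0) := by
    rw [← (hγ 0).2.1]
    exact Measure.isProbabilityMeasure_map measurable_fst.aemeasurable
  -- The chain is started one step earlier, at an arbitrary point from which it jumps to `μ 0`.
  let κ : (n : ℕ) → Kernel (Finset.Iic n → X) X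
    | 0 => Kernel.const _ (μ 0)
    | n + 1 => (γ n).condKernel.comap (fun x => x ⟨n + 1, Finset.mem_Iic.2 le_rfl⟩)
        (measurable_pi_apply _)
  have hκ : ∀ n, IsMarkovKernel (κ n) := by
    rintro (_ | n)
    · simp only [κ]; infer_instance
    · simp only [κ]; infer_instance
  let x₀ : Finset.Iic 0 → X := fun _ => Classical.arbitrary X
  let Q : Measure (ℕ → X) := Kernel.traj (X := fun _ => X) κ 0 x₀
  have hQ : ∀ b, Q.map (Preorder.frestrictLe b) ⊗ₘ κ b =
      Q.map (fun x => (Preorder.frestrictLe (π := fun _ => X) b x, x (b + 1))) := fun b => by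
    rw [← Kernel.partialTraj_compProd_eq_map_traj (X := fun _ => X) (zero_le (a := b)),
      Kernel.traj_map_frestrictLe_apply]
  have hQprob : ∀ b, IsProbabilityMeasure (Q.map (Preorder.frestrictLe (π := fun _ => X) b)) :=
    fun b => Measure.isProbabilityMeasure_map (by fun_prop)
  have hpair : ∀ n, Q.map (fun x => x (n + 1)) = μ n →
      Q.map (fun x => (x (n + 1), x (n + 2))) = γ n := fun n hn => by
    have h := map_compProd_condKernel (Q.map (Preorder.frestrictLe (π := fun _ => X) (n + 1)))
      (f := fun x => x ⟨n + 1, Finset.mem_Iic.2 le_rfl⟩) (measurable_pi_apply _)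
      (ν := μ n) (ρ := μ (n + 1)) ?_ (hγ n)
    · change (Q.map _ ⊗ₘ κ (n + 1)).map _ = _ at h
      rw [hQ, Measure.map_map (by fun_prop) (by fun_prop)] at h
      exact h
    · rw [Measure.map_map (by fun_prop) (by fun_prop)]
      exact hn
  have hone : ∀ n, Q.map (fun x => x (n + 1)) = μ n := fun n => by
    induction n with
    | zero =>
      have h := congrArg (Measure.map Prod.snd) (hQ 0)
      rw [Measure.map_map (by fun_prop) (by fun_prop)] at h
      refine h.symm.trans ?_
      simp only [κ]
      rw [Measure.compProd_const, Measure.map_snd_prod, measure_univ, one_smul]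
    | succ n ih =>
      rw [← (hγ n).2.2, ← hpair n ih, Measure.map_map (by fun_prop) (by fun_prop)]
      rfl
  have hshift : Measurable fun (x : ℕ → X) n => x (n + 1) := by fun_prop
  refine ⟨Q.map fun x n => x (n + 1), Measure.isProbabilityMeasure_map hshift.aemeasurable,
    fun n => ⟨?_, ?_⟩⟩
  · rw [Measure.map_map (by fun_prop) hshift]
    exact hone n
  · rw [Measure.map_map (by fun_prop) hshift]
    exact hpair n (hone n)

section Limits

variable {X : Type*} [NormedAddCommGroup X] [CompleteSpace X]
  [SeparableSpace X] [MeasurableSpace X] [BorelSpace X] {p : ℝ}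

/-- A sequence of probability measures whose consecutive Wasserstein distances are summable has a
limit, both for the Wasserstein distance and weakly: the law of the almost sure limit of the random
sequence that realises nearly optimal plans. -/
theorem exists_wassersteinDist_limit (hp : 1 ≤ p) (μ : ℕ → Measure X)
    [∀ n, IsProbabilityMeasure (μ n)]
    (hsum : ∑' n, wassersteinDist p (μ n) (μ (n + 1)) ≠ ∞) :
    ∃ ν : Measure X, IsProbabilityMeasure ν ∧
      (∀ n, wassersteinDist p (μ n) ν ≤ ∑' k, wassersteinDist p (μ (k + n)) (μ (k + n + 1))) ∧
      ∀ f : X →ᵇ ℝ≥0, Tendsto (fun n => ∫⁻ x, f x ∂μ n) atTop (𝓝 (∫⁻ x, f x ∂ν)) := by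
  have hp0 : 0 < p := by linarith
  obtain ⟨ε, hε, hεsum⟩ := ENNReal.exists_pos_sum_of_countable' one_ne_zero ℕ
  choose γ hγ hcost using fun n =>
    exists_mem_transportPlans_le p (μ n) (μ (n + 1)) (hε n).ne'
  obtain ⟨P, hP, hlaw⟩ := exists_measure_map_pair_eq hγ
  set c := fun n => wassersteinDist p (μ n) (μ (n + 1)) + ε n with hc
  have hcsum : ∑' n, c n ≠ ∞ := by
    rw [hc, ENNReal.tsum_add]
    exact ENNReal.add_ne_top.2 ⟨hsum, (hεsum.trans ENNReal.one_lt_top).ne⟩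
  have hm : ∀ n, Measurable fun x : ℕ → X => edist (x n) (x (n + 1)) := fun n => by fun_prop
  have hLp : ∀ n, (∫⁻ x, edist (x n) (x (n + 1)) ^ p ∂P) ^ (1 / p) ≤ c n := fun n => by
    refine le_trans (le_of_eq ?_) (hcost n)
    rw [← (hlaw n).2, lintegral_map (by fun_prop) (by fun_prop)]
  have hae := ae_tsum_lt_top hp (fun n => (hm n).aemeasurable) hcsum hLp
  obtain ⟨Z, hZ, hZlim⟩ := measurable_limit_of_tendsto_metrizable_ae (μ := P) (L := atTop)
    (f := fun n (x : ℕ → X) => x n) (fun n => (measurable_pi_apply n).aemeasurable) (by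
      filter_upwards [hae] with x hx
      exact cauchySeq_tendsto_of_complete
        (cauchySeq_of_edist_le_of_tsum_ne_top _ (fun n => le_rfl) hx.ne))
  have hbound : ∀ n, wassersteinDist p (μ n) (P.map Z) ≤ ∑' k, c (k + n) := fun n => by
    rw [← (hlaw n).1]
    calc wassersteinDist p (P.map fun x => x n) (P.map Z)
        ≤ (∫⁻ x, edist (x n) (Z x) ^ p ∂P) ^ (1 / p) :=
          wassersteinDist_map_le hp0.le P (measurable_pi_apply n) hZ
      _ ≤ (∫⁻ x, (∑' k, edist (x (k + n)) (x (k + n + 1))) ^ p ∂P) ^ (1 / p) := by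
          refine ENNReal.rpow_le_rpow (lintegral_mono_ae ?_) (by positivity)
          filter_upwards [hZlim] with x hx
          refine ENNReal.rpow_le_rpow ?_ hp0.le
          simp_rw [add_comm _ n]
          exact edist_le_tsum_of_edist_le_of_tendsto _ (fun _ => le_rfl) hx n
      _ ≤ ∑' k, (∫⁻ x, edist (x (k + n)) (x (k + n + 1)) ^ p ∂P) ^ (1 / p) :=
          lintegral_tsum_rpow_le hp fun k => (hm _).aemeasurable
      _ ≤ ∑' k, c (k + n) := ENNReal.tsum_le_tsum fun k => hLp _
  have hlim : Tendsto (fun n => wassersteinDist p (μ n) (P.map Z)) atTop (𝓝 0) :=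
    tendsto_of_tendsto_of_tendsto_of_le_of_le tendsto_const_nhds
      (ENNReal.tendsto_sum_nat_add c hcsum) (fun _ => zero_le) hbound
  refine ⟨P.map Z, Measure.isProbabilityMeasure_map hZ.aemeasurable, fun n => ?_, fun f => ?_⟩
  · have htri : ∀ N, wassersteinDist p (μ n) (P.map Z) ≤
        ∑ k ∈ Finset.range N, wassersteinDist p (μ (k + n)) (μ (k + n + 1)) +
          wassersteinDist p (μ (N + n)) (P.map Z) := fun N => by
      induction N with
      | zero => simp
      | succ N ih =>
        refine ih.trans ?_
        rw [Finset.sum_range_succ, add_assoc, show N + 1 + n = N + n + 1 by ring]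
        gcongr
        exact wassersteinDist_triangle hp _ _ _
    have h := (ENNReal.tendsto_nat_tsum
      fun k => wassersteinDist p (μ (k + n)) (μ (k + n + 1))).add
      ((tendsto_add_atTop_iff_nat n).2 hlim)
    rw [add_zero] at h
    exact ge_of_tendsto' h htri
  · have hf : Measurable fun x => (f x : ℝ≥0∞) := f.continuous.measurable.coe_nnreal_ennreal
    have h1 : ∀ n, ∫⁻ x, f x ∂μ n = ∫⁻ x, f (x n) ∂P := fun n => by
      rw [← (hlaw n).1, lintegral_map hf (measurable_pi_apply n)]
    simp_rw [h1]
    rw [lintegral_map hf hZ]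
    refine tendsto_lintegral_of_dominated_convergence (fun _ => (nndist f 0 : ℝ≥0∞))
      (fun n => hf.comp (measurable_pi_apply n)) (fun n => ae_of_all _ fun x => ?_) ?_ ?_
    · exact ENNReal.coe_le_coe.2 (BoundedContinuousFunction.NNReal.upper_bound f _)
    · simp
    · filter_upwards [hZlim] with x hx
      exact ENNReal.tendsto_coe.2 ((f.continuous.tendsto _).comp hx)

omit [CompleteSpace X] [SeparableSpace X] in
/-- A pointwise weak limit of measurable families of probability measures is measurable. -/
theorem measurable_of_tendsto_lintegral {Ω : Type*} [MeasurableSpace Ω] {κ : ℕ → Ω → Measure X}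
    (hκ : ∀ n, Measurable (κ n)) {ν : Ω → Measure X} [∀ ω, IsProbabilityMeasure (ν ω)]
    (h : ∀ ω, ∀ f : X →ᵇ ℝ≥0, Tendsto (fun n => ∫⁻ x, f x ∂κ n ω) atTop (𝓝 (∫⁻ x, f x ∂ν ω))) :
    Measurable ν := by
  have hf : ∀ f : X →ᵇ ℝ≥0, Measurable fun ω => ∫⁻ x, f x ∂ν ω := fun f => by
    refine measurable_of_tendsto_metrizable (f := fun n ω => ∫⁻ x, f x ∂κ n ω) (fun n => ?_)
      (tendsto_pi_nhds.2 fun ω => h ω f)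
    exact (Measure.measurable_lintegral f.continuous.measurable.coe_nnreal_ennreal).comp (hκ n)
  refine Measurable.measure_of_isPiSystem_of_isProbabilityMeasure
    (S := {s | IsClosed s}) ?_ isPiSystem_isClosed fun F hF => ?_
  · rw [BorelSpace.measurable_eq (α := X), borel_eq_generateFrom_isClosed]
  · refine measurable_of_tendsto_metrizable (fun n => hf (thickenedIndicator
      (Nat.one_div_pos_of_nat (α := ℝ) (n := n)) F)) (tendsto_pi_nhds.2 fun ω => ?_)
    exact tendsto_lintegral_thickenedIndicator_of_isClosed (ν ω) hF
      (fun n => Nat.one_div_pos_of_nat) tendsto_one_div_add_atTop_nhds_zero_nat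

/-- Almost everywhere fibrewise limits of kernels can be chosen measurably. -/
theorem exists_kernel_wassersteinDist_limit {Ω : Type*} [MeasurableSpace Ω] (hp : 1 ≤ p)
    {ρ : Measure Ω} {κ : ℕ → Ω → Measure X} (hκ : ∀ n, Measurable (κ n))
    [∀ n ω, IsProbabilityMeasure (κ n ω)]
    (hsum : ∀ᵐ ω ∂ρ, ∑' n, wassersteinDist p (κ n ω) (κ (n + 1) ω) < ∞) :
    ∃ ν : Ω → Measure X, Measurable ν ∧ (∀ ω, IsProbabilityMeasure (ν ω)) ∧
      ∀ᵐ ω ∂ρ, ∀ n, wassersteinDist p (κ n ω) (ν ω) ≤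
        ∑' k, wassersteinDist p (κ (k + n) ω) (κ (k + n + 1) ω) := by
  classical
  have hp0 : 0 < p := by linarith
  -- On a measurable null set the kernels are replaced by a constant, so that all limits exist.
  obtain ⟨t, hst, ht, ht0⟩ := exists_measurable_superset_of_null (ae_iff.1 hsum)
  let v : ℕ → Ω → Measure X := fun n => t.piecewise (fun _ => Measure.dirac 0) (κ n)
  have hv : ∀ n, Measurable (v n) := fun n => Measurable.piecewise ht measurable_const (hκ n)
  have hvt : ∀ n, ∀ ω ∈ t, v n ω = Measure.dirac 0 := fun n ω hω => Set.piecewise_eq_of_mem _ _ _ hω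
  have hvκ : ∀ n, ∀ ω ∉ t, v n ω = κ n ω := fun n ω hω => Set.piecewise_eq_of_notMem _ _ _ hω
  have hvprob : ∀ n ω, IsProbabilityMeasure (v n ω) := fun n ω => by
    by_cases hω : ω ∈ t
    · rw [hvt n ω hω]; infer_instance
    · rw [hvκ n ω hω]; infer_instance
  have hvsum : ∀ ω, ∑' n, wassersteinDist p (v n ω) (v (n + 1) ω) ≠ ∞ := fun ω => by
    by_cases hω : ω ∈ t
    · simp [hvt _ ω hω, wassersteinDist_self hp0]
    · simp only [hvκ _ ω hω]
      by_contra h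
      exact hω (hst (by simpa using h))
  choose ν hν hle hweak using fun ω => exists_wassersteinDist_limit hp (fun n => v n ω) (hvsum ω)
  refine ⟨ν, measurable_of_tendsto_lintegral hv hweak, hν, ?_⟩
  filter_upwards [measure_eq_zero_iff_ae_notMem.1 ht0] with ω hω n
  simpa only [hvκ _ ω hω] using hle ω n

end Limits

/-! ### The metric structure of the Wasserstein spaces -/

section Metric

variable {Ω X : Type*} [MeasurableSpace Ω] [NormedAddCommGroup X] [CompleteSpace X]
  [SeparableSpace X] [MeasurableSpace X] [BorelSpace X] {p : ℝ} {π : Measure Ω}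

/-- The extended pseudo-metric structure on `P_p(X)` given by the Wasserstein distance. -/
@[reducible]
noncomputable def WassersteinSpace.pseudoEMetricSpace (hp : 1 ≤ p) :
    PseudoEMetricSpace (WassersteinSpace p X) :=
  pseudoEMetricSpaceOfDist (fun μ ν => wassersteinDist p μ.toMeasure ν.toMeasure)
    (fun μ => by
      have := μ.isProb
      exact wassersteinDist_self (by linarith) _)
    (fun _ _ => wassersteinDist_comm p _ _) (fun _ _ _ => wassersteinDist_triangle hp _ _ _)

/-- The distance to the Dirac mass at the origin is the moment, the only plan being the product. -/
theorem wassersteinDist_dirac_zero (hp : 0 < p) (μ : Measure X) [IsProbabilityMeasure μ] :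
    wassersteinDist p μ (Measure.dirac 0) = (∫⁻ x, ‖x‖ₑ ^ p ∂μ) ^ (1 / p) := by
  refine le_antisymm ?_ (le_iInf₂ fun γ hγ => ?_)
  · have h := wassersteinDist_map_le hp.le μ (measurable_id (α := X)) (g := fun _ => 0)
      measurable_const
    simpa [Measure.map_id, Measure.map_const] using h
  · refine ENNReal.rpow_le_rpow (le_of_eq ?_) (by positivity)
    rw [← hγ.2.1, lintegral_map (by fun_prop) measurable_fst]
    have h0 : ∀ᵐ z ∂γ, z.2 = 0 := by
      have h1 : ∀ᵐ x ∂γ.map Prod.snd, x = (0 : X) := by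
        rw [hγ.2.2]
        exact (ae_dirac_iff (measurableSet_singleton 0)).2 rfl
      exact ae_of_ae_map measurable_snd.aemeasurable h1
    refine lintegral_congr_ae ?_
    filter_upwards [h0] with z hz
    rw [hz, edist_zero_right]

namespace FibredWassersteinSpace

theorem simplyApproximable_fibre (hp : 1 ≤ p) (μ : FibredWassersteinSpace p π X) :
    SimplyApproximable p π μ.fibre := by
  have := μ.isProbabilityMeasure_base
  exact SimplyApproximable.of_moment hp π μ.fibre.measurable μ.moment_fibre_lt_top.ne

theorem simplyApproximable_fibre_cond (hp : 1 ≤ p) (μ : FibredWassersteinSpace p π X) {A : Set Ω}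
    (hA : 0 < π A) : SimplyApproximable p (cond π A) μ.fibre := by
  have := μ.isProbabilityMeasure_base
  have := cond_isProbabilityMeasure hA.ne'
  refine SimplyApproximable.of_moment hp _ μ.fibre.measurable ?_
  rw [ProbabilityTheory.cond, lintegral_smul_measure]
  exact (ENNReal.mul_lt_top (ENNReal.inv_lt_top.2 hA)
    ((lintegral_mono' Measure.restrict_le_self le_rfl).trans_lt μ.moment_fibre_lt_top)).ne

theorem aemeasurable_wassersteinDist_fibre (hp : 1 ≤ p) (μ ν : FibredWassersteinSpace p π X) :
    AEMeasurable (fun ω => wassersteinDist p (μ.fibre ω) (ν.fibre ω)) π := by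
  have := μ.isProbabilityMeasure_base
  exact (μ.simplyApproximable_fibre hp).aemeasurable_wassersteinDist hp
    (ν.simplyApproximable_fibre hp)

theorem fibredDist_self (hp : 0 < p) (μ : FibredWassersteinSpace p π X) : fibredDist μ μ = 0 := by
  simp [fibredDist, wassersteinDist_self hp, hp]

theorem fibredDist_comm (μ ν : FibredWassersteinSpace p π X) : fibredDist μ ν = fibredDist ν μ := by
  simp_rw [fibredDist, wassersteinDist_comm p (μ.fibre _)]

theorem fibredDist_triangle (hp : 1 ≤ p) (μ ν ρ : FibredWassersteinSpace p π X) :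
    fibredDist μ ρ ≤ fibredDist μ ν + fibredDist ν ρ := by
  have hp0 : 0 < p := by linarith
  refine le_trans (ENNReal.rpow_le_rpow (lintegral_mono fun ω => ?_) (by positivity))
    (ENNReal.lintegral_Lp_add_le (aemeasurable_wassersteinDist_fibre hp μ ν)
      (aemeasurable_wassersteinDist_fibre hp ν ρ) hp)
  exact ENNReal.rpow_le_rpow (wassersteinDist_triangle hp _ _ _) hp0.le

/-- The extended pseudo-metric structure on `P_{π,p}(Ω × X)` given by the fibred distance. -/
@[reducible]
noncomputable def pseudoEMetricSpace (hp : 1 ≤ p) :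
    PseudoEMetricSpace (FibredWassersteinSpace p π X) :=
  pseudoEMetricSpaceOfDist fibredDist (fibredDist_self (by linarith)) fibredDist_comm
    (fibredDist_triangle hp)

/-- A Markov kernel of finite moment is, almost everywhere, the disintegration of an element of
`P_{π,p}(Ω × X)`. -/
theorem exists_fibre_ae_eq [IsProbabilityMeasure π] {κ : Ω → Measure X} (hκ : Measurable κ)
    [hκprob : ∀ ω, IsProbabilityMeasure (κ ω)] (hfin : ∫⁻ ω, ∫⁻ x, ‖x‖ₑ ^ p ∂κ ω ∂π < ∞) :
    ∃ μ : FibredWassersteinSpace p π X, ∀ᵐ ω ∂π, μ.fibre ω = κ ω := by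
  let k : Kernel Ω X := ⟨κ, hκ⟩
  have hk : IsMarkovKernel k := ⟨hκprob⟩
  have hfst : (π ⊗ₘ k).fst = π := Measure.fst_compProd _ _
  have hae : ∀ᵐ ω ∂π, κ ω = (π ⊗ₘ k).condKernel ω := by
    have h := eq_condKernel_of_measure_eq_compProd (ρ := π ⊗ₘ k) k (by rw [hfst])
    rwa [hfst] at h
  refine ⟨⟨π ⊗ₘ k, inferInstance, hfst, ?_⟩, hae.mono fun ω h => h.symm⟩
  refine lt_of_eq_of_lt (lintegral_congr_ae ?_) hfin
  filter_upwards [hae] with ω h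
  rw [h]

/-- The fibred Wasserstein space is complete: along a sequence with summable consecutive distances
almost every fibre converges. -/
theorem completeSpace (hp : 1 ≤ p) [IsProbabilityMeasure π] :
    @CompleteSpace (FibredWassersteinSpace p π X) (pseudoEMetricSpace hp).toUniformSpace := by
  let _ := pseudoEMetricSpace (π := π) (X := X) hp
  have hp0 : 0 < p := by linarith
  obtain ⟨B, hB, hBsum⟩ := ENNReal.exists_pos_sum_of_countable' one_ne_zero ℕ
  have hBtop : ∑' n, B n ≠ ∞ := (hBsum.trans ENNReal.one_lt_top).ne
  refine EMetric.complete_of_convergent_controlled_sequences B hB fun u hu => ?_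
  have hm : ∀ n, AEMeasurable
      (fun ω => wassersteinDist p ((u n).fibre ω) ((u (n + 1)).fibre ω)) π :=
    fun n => aemeasurable_wassersteinDist_fibre hp _ _
  have hle : ∀ n, (∫⁻ ω, wassersteinDist p ((u n).fibre ω) ((u (n + 1)).fibre ω) ^ p ∂π) ^ (1 / p)
      ≤ B n := fun n => (hu n n (n + 1) le_rfl (Nat.le_succ n)).le
  obtain ⟨ν, hν, hνprob, hlim⟩ := exists_kernel_wassersteinDist_limit hp
    (κ := fun n ω => (u n).fibre ω) (fun n => (u n).fibre.measurable)
    (ae_tsum_lt_top hp hm hBtop hle)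
  have hdist : ∀ n, (∫⁻ ω, (∑' k, wassersteinDist p ((u (k + n)).fibre ω)
      ((u (k + n + 1)).fibre ω)) ^ p ∂π) ^ (1 / p) ≤ ∑' k, B (k + n) := fun n =>
    (lintegral_tsum_rpow_le hp fun k => hm (k + n)).trans
      (ENNReal.tsum_le_tsum fun k => hle (k + n))
  -- The moment of a fibre is its distance to the Dirac mass at `0`, and that of `u 0` is finite.
  have hmoment : ∫⁻ ω, ∫⁻ x, ‖x‖ₑ ^ p ∂ν ω ∂π < ∞ := by
    have hpow : ∀ κ : Ω → Measure X, (∀ ω, IsProbabilityMeasure (κ ω)) →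
        ∀ ω, wassersteinDist p (κ ω) (Measure.dirac 0) ^ p = ∫⁻ x, ‖x‖ₑ ^ p ∂κ ω := by
      intro κ hκ ω
      rw [wassersteinDist_dirac_zero hp0, ← ENNReal.rpow_mul, one_div, inv_mul_cancel₀ hp0.ne',
        ENNReal.rpow_one]
    have hm0 : Measurable fun ω => wassersteinDist p ((u 0).fibre ω) (Measure.dirac 0) := by
      simp_rw [wassersteinDist_dirac_zero hp0]
      exact ((Measure.measurable_lintegral (by fun_prop)).comp (u 0).fibre.measurable).pow_const _
    have h1 : (∫⁻ ω, wassersteinDist p (ν ω) (Measure.dirac 0) ^ p ∂π) ^ (1 / p) ≤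
        ∑' k, B (k + 0) +
          (∫⁻ ω, wassersteinDist p ((u 0).fibre ω) (Measure.dirac 0) ^ p ∂π) ^ (1 / p) := by
      refine le_trans (ENNReal.rpow_le_rpow (lintegral_mono_ae ?_) (by positivity))
        ((ENNReal.lintegral_Lp_add_le (AEMeasurable.tsum fun k => hm (k + 0))
          hm0.aemeasurable hp).trans (add_le_add (hdist 0) le_rfl))
      filter_upwards [hlim] with ω hω
      refine ENNReal.rpow_le_rpow ((wassersteinDist_triangle hp _ ((u 0).fibre ω) _).trans
        (add_le_add ?_ le_rfl)) hp0.le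
      rw [wassersteinDist_comm]
      exact hω 0
    simp_rw [hpow ν hνprob] at h1
    simp_rw [hpow (fun ω => (u 0).fibre ω) (fun ω => inferInstance)] at h1
    have h2 : (∫⁻ ω, ∫⁻ x, ‖x‖ₑ ^ p ∂ν ω ∂π) ^ (1 / p) < ∞ := by
      refine h1.trans_lt (ENNReal.add_lt_top.2 ⟨?_, ?_⟩)
      · simpa using hBtop.lt_top
      · exact ENNReal.rpow_lt_top_of_nonneg (by positivity) (u 0).moment_fibre_lt_top.ne
    exact (ENNReal.rpow_lt_top_iff_of_pos (by positivity)).1 h2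
  obtain ⟨μ, hμ⟩ := exists_fibre_ae_eq (p := p) hν hmoment
  refine ⟨μ, tendsto_iff_edist_tendsto_0.2 ?_⟩
  refine tendsto_of_tendsto_of_tendsto_of_le_of_le tendsto_const_nhds
    (ENNReal.tendsto_sum_nat_add B hBtop) (fun _ => zero_le) fun n => ?_
  refine le_trans (ENNReal.rpow_le_rpow (lintegral_mono_ae ?_) (by positivity)) (hdist n)
  filter_upwards [hlim, hμ] with ω hω hμω
  rw [hμω]
  exact ENNReal.rpow_le_rpow (hω n) hp0.le

end FibredWassersteinSpace

end Metric

/-! ### Finite partitions and conditional expectations -/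

section Partition

variable {Ω X : Type*} [MeasurableSpace Ω] {π : Measure Ω}

/-- Every simple function is almost everywhere constant on the parts of some partition into sets of
positive measure: its null fibres are absorbed by one of the others. -/
theorem exists_finitePositivePartition {β : Type*} [IsProbabilityMeasure π] (s : SimpleFunc Ω β) :
    ∃ P : FinitePositivePartition π, ∀ i, ∃ b, ∀ᵐ ω ∂π.restrict (P.part i), s ω = b := by
  classical
  let R : Finset β := s.range.filter fun b => 0 < π (s ⁻¹' {b})
  -- `R` is the set of values taken with positive probability; `h` sends the others into `R`.
  have hR : ∀ᵐ ω ∂π, s ω ∈ R := by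
    have h0 : π (⋃ b ∈ s.range.filter fun b => ¬ 0 < π (s ⁻¹' {b}), s ⁻¹' {b}) = 0 := by
      refine (measure_biUnion_null_iff (Finset.countable_toSet _)).2 fun b hb => ?_
      simpa using (Finset.mem_filter.1 hb).2
    filter_upwards [measure_eq_zero_iff_ae_notMem.1 h0] with ω hω
    by_contra h
    refine hω (Set.mem_biUnion (x := s ω) ?_ rfl)
    simp only [R, Finset.mem_filter, SimpleFunc.mem_range_self, true_and] at h
    simpa using h
  obtain ⟨ω₀, hω₀⟩ := hR.exists
  let h : β → R := fun b => if hb : b ∈ R then ⟨b, hb⟩ else ⟨s ω₀, hω₀⟩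
  have hh : ∀ b : R, h b = b := fun b => dif_pos b.2
  let e := R.equivFin
  refine ⟨⟨R.card, fun i => (s.map h) ⁻¹' {e.symm i},
    fun i => ((s.map h).measurableSet_fiber _).nullMeasurableSet, fun i => ?_, fun i j hij => ?_,
    ?_⟩, fun i => ⟨(e.symm i).1, ?_⟩⟩
  · refine (Finset.mem_filter.1 (e.symm i).2).2.trans_le (measure_mono fun ω hω => ?_)
    have hω' : s ω = (e.symm i).1 := hω
    change h (s ω) = e.symm i
    rw [hω', hh]
  · refine Set.disjoint_left.2 fun ω hi hj => hij (e.symm.injective ?_)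
    exact (show h (s ω) = e.symm i from hi).symm.trans hj
  · refine Set.eq_univ_of_forall fun ω => Set.mem_iUnion.2 ⟨e (h (s ω)), ?_⟩
    change h (s ω) = e.symm (e (h (s ω)))
    simp
  · filter_upwards [ae_restrict_mem ((s.map h).measurableSet_fiber (e.symm i)),
      ae_restrict_of_ae hR] with ω hω hωR
    have h1 : h (s ω) = e.symm i := hω
    have h2 : h (s ω) = ⟨s ω, hωR⟩ := dif_pos hωR
    rw [← h1, h2]

namespace FinitePositivePartition

theorem lintegral_eq_sum (P : FinitePositivePartition π) (f : Ω → ℝ≥0∞) :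
    ∫⁻ ω, f ω ∂π = ∑ i, ∫⁻ ω in P.part i, f ω ∂π := by
  conv_lhs => rw [← P.sum_restrict]
  rw [lintegral_finsetSum_measure]

theorem sum_measure [IsProbabilityMeasure π] (P : FinitePositivePartition π) :
    ∑ i, π (P.part i) = 1 := by
  have h := P.lintegral_eq_sum fun _ => 1
  simpa using h.symm

end FinitePositivePartition

variable [NormedAddCommGroup X] [CompleteSpace X]
  [SeparableSpace X] [MeasurableSpace X] [BorelSpace X] {p : ℝ}

/-- Convexity of the Wasserstein distance, for averages over a set. -/
theorem measure_mul_wassersteinDist_cond_bind_le (hp : 1 ≤ p) [IsProbabilityMeasure π] {A : Set Ω}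
    (hA : 0 < π A) {κ κ' : Ω → Measure X} (h : SimplyApproximable p (cond π A) κ)
    (h' : SimplyApproximable p (cond π A) κ') :
    π A * wassersteinDist p ((cond π A).bind κ) ((cond π A).bind κ') ^ p ≤
      ∫⁻ ω in A, wassersteinDist p (κ ω) (κ' ω) ^ p ∂π := by
  have hp0 : 0 < p := by linarith
  have := cond_isProbabilityMeasure hA.ne'
  have h1 := ENNReal.rpow_le_rpow (wassersteinDist_bind_le hp (cond π A) h h') hp0.le
  rw [← ENNReal.rpow_mul, one_div, inv_mul_cancel₀ hp0.ne', ENNReal.rpow_one,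
    ProbabilityTheory.cond, lintegral_smul_measure, smul_eq_mul] at h1
  calc π A * wassersteinDist p ((cond π A).bind κ) ((cond π A).bind κ') ^ p
      ≤ π A * ((π A)⁻¹ * ∫⁻ ω in A, wassersteinDist p (κ ω) (κ' ω) ^ p ∂π) := by
        gcongr
        exact h1
    _ = ∫⁻ ω in A, wassersteinDist p (κ ω) (κ' ω) ^ p ∂π := by
        rw [← mul_assoc, ENNReal.mul_inv_cancel hA.ne' (measure_ne_top _ _), one_mul]

namespace FibredWassersteinSpace

theorem measure_mul_wassersteinDist_average_le (hp : 1 ≤ p) (μ ν : FibredWassersteinSpace p π X)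
    {A : Set Ω} (hA : 0 < π A) :
    π A * wassersteinDist p (μ.average A hA).toMeasure (ν.average A hA).toMeasure ^ p ≤
      ∫⁻ ω in A, wassersteinDist p (μ.fibre ω) (ν.fibre ω) ^ p ∂π := by
  have := μ.isProbabilityMeasure_base
  exact measure_mul_wassersteinDist_cond_bind_le hp hA (μ.simplyApproximable_fibre_cond hp hA)
    (ν.simplyApproximable_fibre_cond hp hA)

/-- Averaging over a set of positive measure is Lipschitz. -/
theorem wassersteinDist_average_le (hp : 1 ≤ p) (μ ν : FibredWassersteinSpace p π X)
    {A : Set Ω} (hA : 0 < π A) :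
    wassersteinDist p (μ.average A hA).toMeasure (ν.average A hA).toMeasure ≤
      (π A)⁻¹ ^ (1 / p) * fibredDist μ ν := by
  have := μ.isProbabilityMeasure_base
  have hp0 : 0 < p := by linarith
  have h := (μ.measure_mul_wassersteinDist_average_le hp ν hA).trans
    (lintegral_mono' Measure.restrict_le_self le_rfl)
  rw [mul_comm, ← ENNReal.le_div_iff_mul_le (Or.inl hA.ne') (Or.inl (measure_ne_top _ _)),
    ENNReal.div_eq_inv_mul] at h
  have h1 := ENNReal.rpow_le_rpow h (z := 1 / p) (by positivity)
  rwa [← ENNReal.rpow_mul, mul_one_div_cancel hp0.ne', ENNReal.rpow_one,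
    ENNReal.mul_rpow_of_nonneg _ _ (by positivity)] at h1

/-- The fibres of a conditional expectation are the averages over the parts. -/
theorem ae_fibre_condExp_eq (μ : FibredWassersteinSpace p π X) (P : FinitePositivePartition π)
    (i : Fin P.n) : ∀ᵐ ω ∂π.restrict (P.part i),
      (μ.condExp P).fibre ω = (μ.average (P.part i) (P.pos i)).toMeasure := by
  classical
  have := μ.isProbabilityMeasure_base
  have hav := fun i => (μ.average (P.part i) (P.pos i)).isProb
  have := μ.isProbabilityMeasure_condExpMeasure P
  -- The parts are only null measurable, so the kernel is built on measurable versions of them.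
  choose B hBm hB using fun i => (P.nullMeasurableSet i)
  let κ : Kernel Ω X := ∑ i, Kernel.piecewise (hBm i)
    (Kernel.const Ω (μ.average (P.part i) (P.pos i)).toMeasure) 0
  have hκ : ∀ ω, κ ω = ∑ i, (B i).indicator
      (fun _ => (μ.average (P.part i) (P.pos i)).toMeasure) ω := fun ω => by
    simp only [κ]
    rw [sum_apply]
    refine Finset.sum_congr rfl fun i _ => ?_
    rw [Kernel.piecewise_apply]
    by_cases hω : ω ∈ B i <;> simp [hω]
  have hfin : IsFiniteKernel κ := ⟨P.n, by simp, fun ω => by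
    rw [hκ, Measure.finsetSum_apply]
    refine (Finset.sum_le_sum (g := fun _ => 1) fun i _ => ?_).trans_eq (by simp)
    by_cases hω : ω ∈ B i <;> simp [hω]⟩
  have hfst : (μ.condExpMeasure P).fst = π := μ.condExpMeasure_fst P
  have hcomp : μ.condExpMeasure P = (μ.condExpMeasure P).fst ⊗ₘ κ := by
    rw [hfst]
    ext S hS
    rw [Measure.compProd_apply hS, condExpMeasure, Measure.finsetSum_apply]
    simp_rw [hκ, Measure.finsetSum_apply]
    rw [lintegral_finsetSum']
    · refine Finset.sum_congr rfl fun i _ => ?_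
      rw [Measure.prod_apply hS, Measure.restrict_congr_set (hB i), ← lintegral_indicator (hBm i)]
      refine lintegral_congr fun ω => ?_
      by_cases hω : ω ∈ B i <;> simp [hω]
    · intro i _
      have hm := (measurable_measure_prodMk_left
        (ν := (μ.average (P.part i) (P.pos i)).toMeasure) hS).indicator (hBm i)
      convert hm.aemeasurable using 1
      funext ω
      by_cases hω : ω ∈ B i <;> simp [hω]
  have h := eq_condKernel_of_measure_eq_compProd κ hcomp
  rw [hfst] at h
  have hpart : ∀ᵐ ω ∂π, ∀ j, ω ∈ P.part j ↔ ω ∈ B j := by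
    refine ae_all_iff.2 fun j => ?_
    filter_upwards [hB j] with ω hω
    exact hω.to_iff
  have hmem : ∀ᵐ ω ∂π.restrict (P.part i), ω ∈ P.part i := ae_restrict_mem₀ (P.nullMeasurableSet i)
  filter_upwards [ae_restrict_of_ae h, ae_restrict_of_ae hpart, hmem] with ω h1 h2 h3
  refine h1.symm.trans ?_
  rw [hκ, Finset.sum_eq_single i]
  · exact Set.indicator_of_mem ((h2 i).1 h3) _
  · intro j _ hji
    refine Set.indicator_of_notMem (fun hj => ?_) _
    exact Set.disjoint_left.1 (P.pairwiseDisjoint hji) ((h2 j).2 hj) h3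
  · simp

theorem fibredDist_condExp_condExp (μ ν : FibredWassersteinSpace p π X)
    (P : FinitePositivePartition π) :
    fibredDist (μ.condExp P) (ν.condExp P) = (∑ i, π (P.part i) *
      wassersteinDist p (μ.average (P.part i) (P.pos i)).toMeasure
        (ν.average (P.part i) (P.pos i)).toMeasure ^ p) ^ (1 / p) := by
  rw [fibredDist, P.lintegral_eq_sum]
  congr 1
  refine Finset.sum_congr rfl fun i _ => ?_
  rw [mul_comm, ← setLIntegral_const]
  refine lintegral_congr_ae ?_
  filter_upwards [μ.ae_fibre_condExp_eq P i, ν.ae_fibre_condExp_eq P i] with ω h1 h2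
  rw [h1, h2]

/-- Conditional expectations do not increase distances. -/
theorem fibredDist_condExp_condExp_le (hp : 1 ≤ p) (μ ν : FibredWassersteinSpace p π X)
    (P : FinitePositivePartition π) :
    fibredDist (μ.condExp P) (ν.condExp P) ≤ fibredDist μ ν := by
  rw [fibredDist_condExp_condExp, fibredDist, P.lintegral_eq_sum]
  refine ENNReal.rpow_le_rpow (Finset.sum_le_sum fun i _ => ?_) (by positivity)
  exact μ.measure_mul_wassersteinDist_average_le hp ν (P.pos i)

theorem fibredDist_condExp_condExp_le_of_forall (hp : 1 ≤ p) (μ ν : FibredWassersteinSpace p π X)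
    (P : FinitePositivePartition π) {r : ℝ≥0∞}
    (h : ∀ i, wassersteinDist p (μ.average (P.part i) (P.pos i)).toMeasure
      (ν.average (P.part i) (P.pos i)).toMeasure ≤ r) :
    fibredDist (μ.condExp P) (ν.condExp P) ≤ r := by
  have := μ.isProbabilityMeasure_base
  have hp0 : 0 < p := by linarith
  rw [fibredDist_condExp_condExp]
  calc _ ≤ (∑ i, π (P.part i) * r ^ p) ^ (1 / p) := by
        gcongr with i
        exact h i
    _ = r := by
        rw [← Finset.sum_mul, P.sum_measure, one_mul, ← ENNReal.rpow_mul,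
          mul_one_div_cancel hp0.ne', ENNReal.rpow_one]

/-- A kernel that is almost everywhere constant on the parts of `P` is no closer to `μ` than to the
conditional expectation of `μ`. -/
theorem lintegral_wassersteinDist_condExp_le (hp : 1 ≤ p) (μ : FibredWassersteinSpace p π X)
    (P : FinitePositivePartition π) (s : SimpleFunc Ω (Measure X))
    (hs : ∀ ω, IsProbabilityMeasure (s ω))
    (hP : ∀ i, ∃ b, ∀ᵐ ω ∂π.restrict (P.part i), s ω = b) :
    ∫⁻ ω, wassersteinDist p (s ω) ((μ.condExp P).fibre ω) ^ p ∂π ≤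
      ∫⁻ ω, wassersteinDist p (s ω) (μ.fibre ω) ^ p ∂π := by
  have := μ.isProbabilityMeasure_base
  have hp0 : 0 < p := by linarith
  rw [P.lintegral_eq_sum, P.lintegral_eq_sum]
  refine Finset.sum_le_sum fun i _ => ?_
  obtain ⟨b, hb⟩ := hP i
  have := cond_isProbabilityMeasure (P.pos i).ne'
  have hbind : (cond π (P.part i)).bind s = b := by
    have hb' : (s : Ω → Measure X) =ᵐ[cond π (P.part i)] fun _ => b :=
      (Measure.smul_absolutelyContinuous (c := (π (P.part i))⁻¹)) hb
    rw [Measure.bind_congr_right hb', Measure.bind_const, measure_univ, one_smul]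
  have h := measure_mul_wassersteinDist_cond_bind_le hp (P.pos i)
    (SimplyApproximable.of_simpleFunc hp0 _ s) (μ.simplyApproximable_fibre_cond hp (P.pos i))
  rw [hbind] at h
  refine le_trans (le_of_eq ?_) h
  rw [mul_comm, ← setLIntegral_const]
  refine lintegral_congr_ae ?_
  filter_upwards [hb, μ.ae_fibre_condExp_eq P i] with ω h1 h2
  rw [h1, h2]
  rfl

/-- Finitely many elements are simultaneously close to their conditional expectations. -/
theorem exists_partition_fibredDist_condExp_le (hp : 1 ≤ p) [IsProbabilityMeasure π] {ι : Type*}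
    [Finite ι] (μ : ι → FibredWassersteinSpace p π X) {ε : ℝ≥0∞} (hε : 0 < ε) :
    ∃ P : FinitePositivePartition π, ∀ j, fibredDist (μ j) ((μ j).condExp P) ≤ ε := by
  have hp0 : 0 < p := by linarith
  choose s hs hclose using fun j =>
    (μ j).simplyApproximable_fibre hp (ε / 2) (ENNReal.half_pos hε.ne')
  obtain ⟨P, hP⟩ := exists_finitePositivePartition (π := π) (simpleFuncPi s)
  refine ⟨P, fun j => ?_⟩
  obtain ⟨g, hg, hle, hgε, -⟩ := hclose j
  have hsμ : (∫⁻ ω, wassersteinDist p (s j ω) ((μ j).fibre ω) ^ p ∂π) ^ (1 / p) ≤ ε / 2 := by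
    refine le_trans (ENNReal.rpow_le_rpow (lintegral_mono fun ω => ?_) (by positivity)) hgε
    rw [wassersteinDist_comm]
    exact ENNReal.rpow_le_rpow (hle ω) hp0.le
  have hconst : ∀ i, ∃ b, ∀ᵐ ω ∂π.restrict (P.part i), s j ω = b := fun i => by
    obtain ⟨b, hb⟩ := hP i
    exact ⟨b j, hb.mono fun ω h => congrFun h j⟩
  have hm := (SimplyApproximable.of_simpleFunc hp0 π (s j)).aemeasurable_wassersteinDist hp
    (((μ j).condExp P).simplyApproximable_fibre hp)
  calc fibredDist (μ j) ((μ j).condExp P)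
      ≤ (∫⁻ ω, (g ω + wassersteinDist p (s j ω) (((μ j).condExp P).fibre ω)) ^ p ∂π) ^ (1 / p) := by
        refine ENNReal.rpow_le_rpow (lintegral_mono fun ω => ?_) (by positivity)
        exact ENNReal.rpow_le_rpow ((wassersteinDist_triangle hp _ (s j ω) _).trans
          (add_le_add (hle ω) le_rfl)) hp0.le
    _ ≤ ε / 2 + ε / 2 := by
        refine (ENNReal.lintegral_Lp_add_le hg.aemeasurable hm hp).trans (add_le_add hgε ?_)
        exact (ENNReal.rpow_le_rpow (lintegral_wassersteinDist_condExp_le hp (μ j) P (s j) (hs j)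
          hconst) (by positivity)).trans hsμ
    _ = ε := ENNReal.add_halves ε

end FibredWassersteinSpace

end Partition

/-! ### The compactness criterion -/

section Compactness

variable {Ω X : Type*} [MeasurableSpace Ω] [NormedAddCommGroup X] [CompleteSpace X]
  [SeparableSpace X] [MeasurableSpace X] [BorelSpace X] {p : ℝ} {π : Measure Ω}
  {K : Set (FibredWassersteinSpace p π X)}

namespace FibredWassersteinSpace

theorem continuous_average (hp : 1 ≤ p) [IsProbabilityMeasure π] {A : Set Ω} (hA : 0 < π A) :
    Continuous fun μ : FibredWassersteinSpace p π X => μ.average A hA := by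
  let _ := pseudoEMetricSpace (π := π) (X := X) hp
  let _ := WassersteinSpace.pseudoEMetricSpace (X := X) hp
  have hC : (π A)⁻¹ ^ (1 / p) ≠ ∞ :=
    (ENNReal.rpow_lt_top_of_nonneg (by positivity) (ENNReal.inv_ne_top.2 hA.ne')).ne
  have h : LipschitzWith ((π A)⁻¹ ^ (1 / p)).toNNReal
      fun μ : FibredWassersteinSpace p π X => μ.average A hA := fun μ ν => by
    rw [ENNReal.coe_toNNReal hC]
    exact wassersteinDist_average_le hp μ ν hA
  exact h.continuous

theorem isCompact_closure_average (hp : 1 ≤ p) [IsProbabilityMeasure π] (hK : IsCompact (closure K))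
    {A : Set Ω} (hA : 0 < π A) :
    IsCompact (closure {ν : WassersteinSpace p X | ∃ μ ∈ K, ν = μ.average A hA}) := by
  have h := hK.image (continuous_average hp hA)
  let _ := WassersteinSpace.pseudoEMetricSpace (X := X) hp
  refine h.closure_of_subset ?_
  rintro _ ⟨μ, hμ, rfl⟩
  exact ⟨μ, subset_closure hμ, rfl⟩

/-- A partition adapted to a finite net of `K` serves for all of `K`, conditional expectations being
contractions. -/
theorem exists_partition_of_isCompact_closure (hp : 1 ≤ p) [IsProbabilityMeasure π]
    (hK : IsCompact (closure K)) {ε : ℝ≥0∞} (hε : 0 < ε) :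
    ∃ P : FinitePositivePartition π, ∀ μ ∈ K, fibredDist μ (μ.condExp P) ≤ ε := by
  let _ := pseudoEMetricSpace (π := π) (X := X) hp
  have hδ : 0 < ε / 3 := ENNReal.div_pos hε.ne' (by simp)
  obtain ⟨t, ht, hKt⟩ := EMetric.totallyBounded_iff.1
    (hK.totallyBounded.subset subset_closure) (ε / 3) hδ
  have := ht.to_subtype
  obtain ⟨P, hP⟩ := exists_partition_fibredDist_condExp_le hp (fun ν : t => ν.1) hδ
  refine ⟨P, fun μ hμ => ?_⟩
  obtain ⟨ν, hν, hμν⟩ := Set.mem_iUnion₂.1 (hKt hμ)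
  have hμν' : fibredDist μ ν ≤ ε / 3 := le_of_lt hμν
  calc fibredDist μ (μ.condExp P)
      ≤ fibredDist μ ν + (fibredDist ν (ν.condExp P) +
          fibredDist (ν.condExp P) (μ.condExp P)) :=
        (fibredDist_triangle hp _ ν _).trans (add_le_add le_rfl (fibredDist_triangle hp _ _ _))
    _ ≤ ε / 3 + (ε / 3 + ε / 3) := by
        gcongr
        · exact hP ⟨ν, hν⟩
        · refine (fibredDist_condExp_condExp_le hp ν μ P).trans ?_
          rwa [fibredDist_comm]
    _ = ε := by rw [← add_assoc, ENNReal.add_thirds]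

theorem totallyBounded_of_average_of_partition (hp : 1 ≤ p) [IsProbabilityMeasure π]
    (havg : ∀ A : Set Ω, NullMeasurableSet A π → ∀ hA : 0 < π A,
      IsCompact (closure {ν : WassersteinSpace p X | ∃ μ ∈ K, ν = μ.average A hA}))
    (hpart : ∀ ε : ℝ≥0∞, 0 < ε → ∃ P : FinitePositivePartition π,
      ∀ μ ∈ K, fibredDist μ (μ.condExp P) ≤ ε) :
    @TotallyBounded _ (pseudoEMetricSpace hp).toUniformSpace K := by
  let _ := pseudoEMetricSpace (π := π) (X := X) hp
  let _ := WassersteinSpace.pseudoEMetricSpace (X := X) hp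
  refine totallyBounded_of_edist_le fun ε hε => ?_
  obtain ⟨P, hP⟩ := hpart (ε / 2) (ENNReal.half_pos hε.ne')
  refine ⟨Fin P.n → WassersteinSpace p X, inferInstance,
    fun μ i => μ.average (P.part i) (P.pos i), ?_, fun μ hμ ν hν => ?_⟩
  · refine (isCompact_univ_pi fun i =>
      havg (P.part i) (P.nullMeasurableSet i) (P.pos i)).totallyBounded.subset ?_
    rintro _ ⟨μ, hμ, rfl⟩ i -
    exact subset_closure ⟨μ, hμ, rfl⟩
  · calc fibredDist μ ν
        ≤ fibredDist μ (μ.condExp P) + (fibredDist (μ.condExp P) (ν.condExp P) +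
            fibredDist (ν.condExp P) ν) :=
          (fibredDist_triangle hp _ _ _).trans (add_le_add le_rfl (fibredDist_triangle hp _ _ _))
      _ ≤ ε / 2 + (edist (fun i => μ.average (P.part i) (P.pos i))
            (fun i => ν.average (P.part i) (P.pos i)) + ε / 2) := by
          gcongr
          · exact hP μ hμ
          · exact fibredDist_condExp_condExp_le_of_forall hp μ ν P fun i =>
              edist_le_pi_edist (fun i => μ.average (P.part i) (P.pos i))
                (fun i => ν.average (P.part i) (P.pos i)) i
          · rw [fibredDist_comm]
            exact hP ν hν
      _ = ε + edist (fun i => μ.average (P.part i) (P.pos i))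
            (fun i => ν.average (P.part i) (P.pos i)) := by
          rw [add_comm (edist _ _), ← add_assoc, ENNReal.add_halves]

theorem isCompact_closure_of_totallyBounded (hp : 1 ≤ p) [IsProbabilityMeasure π]
    (hK : @TotallyBounded _ (pseudoEMetricSpace hp).toUniformSpace K) : IsCompact (closure K) := by
  let _ := pseudoEMetricSpace (π := π) (X := X) hp
  have := completeSpace (π := π) (X := X) hp
  exact hK.closure.isCompact_of_isClosed isClosed_closure

end FibredWassersteinSpace

end Compactness

theorem mainTheorem6 {Ω X : Type*}
    [TopologicalSpace Ω] [PolishSpace Ω] [MeasurableSpace Ω] [BorelSpace Ω]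
    [NormedAddCommGroup X] [NormedSpace ℝ X] [CompleteSpace X] [SeparableSpace X]
    [MeasurableSpace X] [BorelSpace X]
    (π : Measure Ω) [IsProbabilityMeasure π] (p : ℝ) (hp : 1 ≤ p)
    (K : Set (FibredWassersteinSpace p π X)) :
    IsCompact (closure K) ↔
      (∀ A : Set Ω, NullMeasurableSet A π → ∀ hA : 0 < π A,
        IsCompact (closure {ν : WassersteinSpace p X | ∃ μ ∈ K, ν = μ.average A hA})) ∧
      (∀ ε : ℝ, 0 < ε → ∃ P : FinitePositivePartition π,
        ⨆ μ ∈ K, FibredWassersteinSpace.fibredDist μ (μ.condExp P) ≤ ENNReal.ofReal ε) := by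
  refine ⟨fun hK => ⟨fun A _ hA => FibredWassersteinSpace.isCompact_closure_average hp hK hA,
    fun ε hε => ?_⟩, fun h => FibredWassersteinSpace.isCompact_closure_of_totallyBounded hp
      (FibredWassersteinSpace.totallyBounded_of_average_of_partition hp h.1 fun ε hε => ?_)⟩
  · obtain ⟨P, hP⟩ := FibredWassersteinSpace.exists_partition_of_isCompact_closure hp hK
      (ENNReal.ofReal_pos.2 hε)
    exact ⟨P, iSup₂_le hP⟩
  · obtain ⟨r, hr, hrε⟩ := ENNReal.lt_iff_exists_nnreal_btwn.1 hε
    obtain ⟨P, hP⟩ := h.2 r (by simpa using hr)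
    refine ⟨P, fun μ hμ => ?_⟩
    rw [ENNReal.ofReal_coe_nnreal] at hP
    exact (iSup₂_le_iff.1 hP μ hμ).trans hrε.le
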